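/- **Setting.** Let $B$ be the closure of a braid word with letters $\sigma_{i}^{\pm1}$ on $b\ge 1$ strands, $w$ its writhe, $K_1,\dots,K_m$ its components. Assign a variable of degree $2$ to every edge of the diagram, numbered so that the $l$-th edge lies on $K_l$ for $1\le l\le m$ (a strand without crossings closes up to one edge). The edge ring $R(B)$ is $\mathbb{Q}[X_1,\dots,X_M]$ modulo the relations $X_k+X_l-X_i-X_j$, one for each crossing with left and right outgoing edges $k,l$ and left and right incoming edges $i,j$; the reduced edge ring is $R_r(B)=\mathbb{Q}[X_2-X_1,\dots,X_M-X_1]$ modulo the same relations. Put $\alpha=X_k-X_i$ and $\gamma=X_l-X_i$. Write $\{s,t,u\}$ for the shift of a $\mathbb{Z}^3$-grading upwards by $(s,t,u)$. To a positive crossing assign the square with rows $$R\{0,-2,0\}\xrightarrow{\ \alpha\ }R\{0,0,0\}\ \text{(top)},\qquad R\{2,-2,-2\}\xrightarrow{\ \alpha\gamma\ }R\{0,0,-2\}\ \text{(bottom)},$$ and upward arrows $\gamma$ (left), $1$ (right); to a negative crossing the square with rows $$R\{0,-2,2\}\xrightarrow{\ \alpha\gamma\ }R\{-2,0,2\}\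 \text{(top)},\qquad R\{0,-2,0\}\xrightarrow{\ \alpha\ }R\{0,0,0\}\ \text{(bottom)},$$ and upward arrows $1$ (left), $\gamma$ (right). Let $C_0(B)$ (resp. $C_r(B)$) be the tensor product of these double complexes over all crossings, with $R=R(B)$ (resp. $R=R_r(B)$), horizontal differential $d_+$ and vertical differential $d_v$. The middle HOMFLYPT homology and its reduction are the $\mathbb{Z}^3$-graded spaces $$H(B)=H(H(C_0(B),d_+),d_v)\{-w+b,\,w+b-1,\,w-b+1\},$$ $$H_r(B)=H(H(C_r(B),d_+),d_v)\{-w+b-1,\,w+b-1,\,w-b+1\}.$$ If $B$ is a knot, its reduced HOMFLYPT homology $\overline H(B)$ is the homology $H(H(C_0(B)/X_xC_0(B),d_+),d_v)$ of the quotient complex for a marked edge $x$, with the same shift as $H_r(B)$. Let $R_B=\mathbb{Q}[X_1,\dots,X_m]$ and $R_{B,r}=\mathbb{Q}[X_2-X_1,\dots,X_m-X_1]$, with $\deg X_l=2$; $R_B$ acts on $H(B)$, and $R_{B,r}$ on $H_r(B)$, through the variables of the first $m$ edges. Let $\mathfrak m=(X_1,\dots,X_m)\subset R_B$ and $\mathfrak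 m_r=(X_2-X_1,\dots,X_m-X_1)\subset R_{B,r}$, and write $H^{\star,j,k}=\bigoplus_{i}H^{i,j,k}$. For $(p,q,j,k)\in\mathbb{Z}_{\ge0}\times\mathbb{Z}^3$ the Betti numbers are the dimensions of the degree-$q$ components of the graded $\mathrm{Tor}$ spaces $$\beta_B(p,q,j,k)=\dim_{\mathbb Q}\mathrm{Tor}^{R_B}_p(R_B/\mathfrak m,H^{\star,j,k}(B))^q,$$ $$\beta_{B,r}(p,q,j,k)=\dim_{\mathbb Q}\mathrm{Tor}^{R_{B,r}}_p(R_{B,r}/\mathfrak m_r,H_r^{\star,j,k}(B))^q.$$ **Theorem 1.5.** For every closed braid $B$ and all $(p,q,j,k)\in\mathbb{Z}_{\ge0}\times\mathbb{Z}^3$, $$\beta_B(p,q,j,k)=\beta_{B,r}(p,q-1,j,k).$$ In particular, if $B$ is a knot, then for all $q,j,k\in\mathbb{Z}$ $$\beta_B(0,q,j,k)=\dim_{\mathbb Q}H_r^{q-1,j,k}(B)=\dim_{\mathbb Q}\overline H^{\,q-1,j,k}(B),$$ and $\beta_B(p,q,j,k)=0$ whenever $p>0$. -/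

import Mathlib

open scoped TensorProduct

namespace HOMFLYPT

noncomputable section

/-! ### Subquotients and homology -/

/-- The subquotient `Z / (W ∩ Z)` of a module `M` (so `Z / W` when `W ≤ Z`). -/
abbrev SubQuot {R M : Type} [CommRing R] [AddCommGroup M] [Module R M]
    (Z W : Submodule R M) : Type :=
  ↥Z ⧸ W.submoduleOf Z

/-- The part of the subquotient `Z / W` of all classes represented by an element of `Z ∩ N`,
where `N` is a subspace over a smaller ring of scalars `k` (for instance a homogeneous component
of `M`). -/
def SubQuot.part {R M : Type} (k : Type) [CommRing R] [CommRing k] [Algebra k R]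
    [AddCommGroup M] [Module R M] [Module k M] [IsScalarTower k R M]
    (Z W : Submodule R M) (N : Submodule k M) : Submodule k (SubQuot Z W) :=
  (N.comap (Z.subtype.restrictScalars k)).map ((W.submoduleOf Z).mkQ.restrictScalars k)

/-- The homology `ker d / im d` of a module with a differential `d`. -/
abbrev Homology {R M : Type} [CommRing R] [AddCommGroup M] [Module R M]
    (d : M →ₗ[R] M) : Type :=
  SubQuot (LinearMap.ker d) (LinearMap.range d)

/-- The map induced on the homology of `d` by a map `g` that commutes with `d`. -/
def Homology.induced {R M : Type} [CommRing R] [AddCommGroup M] [Module R M]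
    (d g : M →ₗ[R] M) (h : d ∘ₗ g = g ∘ₗ d) : Homology d →ₗ[R] Homology d :=
  Submodule.mapQ _ _
    (g.restrict (p := LinearMap.ker d) (q := LinearMap.ker d) (fun x hx => by
      have h1 := LinearMap.congr_fun h x
      simp only [LinearMap.comp_apply] at h1
      rw [LinearMap.mem_ker] at hx ⊢
      rw [h1, hx, map_zero]))
    (by
      rintro ⟨x, hx⟩ ⟨y, hy⟩
      refine ⟨g y, ?_⟩
      have h1 := LinearMap.congr_fun h y
      simp only [LinearMap.comp_apply] at h1
      rw [h1, hy]
      rfl)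

/-! ### Graded Tor

`R` is a commutative `ℚ`-algebra with homogeneous components `𝒜 n`, `n ∈ ℤ`.  The homogeneous
components of a graded module are likewise given by a family of `ℚ`-subspaces. -/

/-- The homogeneous component of degree `q` of the graded free module `⨁_b R{deg b}`, in which the
basis element `b` has degree `deg b`. -/
def freeDeg {R : Type} [CommRing R] [Algebra ℚ R] (𝒜 : ℤ → Submodule ℚ R)
    {ι : Type} (deg : ι → ℤ) (q : ℤ) : Submodule ℚ (ι →₀ R) where
  carrier := {f | ∀ b, f b ∈ 𝒜 (q - deg b)}
  add_mem' := fun hf hg b => (𝒜 _).add_mem (hf b) (hg b)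
  zero_mem' := fun _ => (𝒜 _).zero_mem
  smul_mem' := fun r _ hf b => (𝒜 _).smul_mem r (hf b)

/-- A graded free module `⨁_b R{deg b}` together with a submodule of it. -/
structure FreeWithSubmodule (R : Type) [CommRing R] where
  gens : Type
  deg : gens → ℤ
  sub : Submodule R (gens →₀ R)

/-- The standard cover of a graded module `M`: the graded free module with one basis element of
degree `i` for each element of `M` of degree `i`, together with the kernel of the
tautological map to `M`. -/
def standardCover {R M : Type} [CommRing R] [AddCommGroup M] [Module R M] [Module ℚ M]
    (ℳ : ℤ → Submodule ℚ M) : FreeWithSubmodule R where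
  gens := Σ i : ℤ, ↥(ℳ i)
  deg := fun b => b.1
  sub := LinearMap.ker (Finsupp.linearCombination R (fun b : (Σ i : ℤ, ↥(ℳ i)) => (b.2 : M)))

/-- The standard cover of the submodule in `F`, with the grading induced from the free module. -/
def nextCover {R : Type} [CommRing R] [Algebra ℚ R] (𝒜 : ℤ → Submodule ℚ R)
    (F : FreeWithSubmodule R) : FreeWithSubmodule R where
  gens := Σ i : ℤ, {x : F.gens →₀ R // x ∈ F.sub ∧ x ∈ freeDeg 𝒜 F.deg i}
  deg := fun b => b.1
  sub := LinearMap.ker (Finsupp.linearCombination R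
    (fun b : (Σ i : ℤ, {x : F.gens →₀ R // x ∈ F.sub ∧ x ∈ freeDeg 𝒜 F.deg i}) => b.2.1))

/-- The standard graded free resolution `⋯ → F₂ → F₁ → F₀` of a graded module `M`, where each term
comes with the kernel of the next map to the right. -/
def resolution {R M : Type} [CommRing R] [Algebra ℚ R] (𝒜 : ℤ → Submodule ℚ R)
    [AddCommGroup M] [Module R M] [Module ℚ M] (ℳ : ℤ → Submodule ℚ M) :
    ℕ → FreeWithSubmodule R
  | 0 => standardCover ℳ
  | p + 1 => nextCover 𝒜 (resolution 𝒜 ℳ p)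

/-- The free module `F_p` in the standard graded free resolution of `M`. -/
abbrev ResModule {R M : Type} [CommRing R] [Algebra ℚ R] (𝒜 : ℤ → Submodule ℚ R)
    [AddCommGroup M] [Module R M] [Module ℚ M] (ℳ : ℤ → Submodule ℚ M) (p : ℕ) : Type :=
  (resolution 𝒜 ℳ p).gens →₀ R

/-- The boundary map `F_{p+1} → F_p` of the standard graded free resolution. -/
def resBoundary {R M : Type} [CommRing R] [Algebra ℚ R] (𝒜 : ℤ → Submodule ℚ R)
    [AddCommGroup M] [Module R M] [Module ℚ M] (ℳ : ℤ → Submodule ℚ M) (p : ℕ) :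
    ResModule 𝒜 ℳ (p + 1) →ₗ[R] ResModule 𝒜 ℳ p :=
  Finsupp.linearCombination R
    (fun b : (Σ i : ℤ, {x : (resolution 𝒜 ℳ p).gens →₀ R //
      x ∈ (resolution 𝒜 ℳ p).sub ∧ x ∈ freeDeg 𝒜 (resolution 𝒜 ℳ p).deg i}) => b.2.1)

/-- The homogeneous component of degree `q` of the tensor product of two graded modules. -/
def tensorDeg {R N F : Type} [CommRing R] [Algebra ℚ R]
    [AddCommGroup N] [Module R N] [Module ℚ N] [IsScalarTower ℚ R N]
    [AddCommGroup F] [Module R F] [Module ℚ F]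
    (𝒩 : ℤ → Submodule ℚ N) (ℱ : ℤ → Submodule ℚ F) (q : ℤ) : Submodule ℚ (N ⊗[R] F) :=
  Submodule.span ℚ {z | ∃ a b : ℤ, a + b = q ∧ ∃ x ∈ 𝒩 a, ∃ y ∈ ℱ b, z = x ⊗ₜ[R] y}

/-- The boundary map `N ⊗ F_{p+1} → N ⊗ F_p`. -/
def torBoundary {R N M : Type} [CommRing R] [Algebra ℚ R] (𝒜 : ℤ → Submodule ℚ R)
    [AddCommGroup N] [Module R N]
    [AddCommGroup M] [Module R M] [Module ℚ M] (ℳ : ℤ → Submodule ℚ M) (p : ℕ) :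
    N ⊗[R] ResModule 𝒜 ℳ (p + 1) →ₗ[R] N ⊗[R] ResModule 𝒜 ℳ p :=
  LinearMap.lTensor N (resBoundary 𝒜 ℳ p)

/-- The `p`-cycles of the complex `⋯ → N ⊗ F₁ → N ⊗ F₀ → 0`. -/
def torCycles {R M : Type} (N : Type) [CommRing R] [Algebra ℚ R] (𝒜 : ℤ → Submodule ℚ R)
    [AddCommGroup N] [Module R N]
    [AddCommGroup M] [Module R M] [Module ℚ M] (ℳ : ℤ → Submodule ℚ M) :
    (p : ℕ) → Submodule R (N ⊗[R] ResModule 𝒜 ℳ p)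
  | 0 => ⊤
  | p + 1 => LinearMap.ker (torBoundary 𝒜 ℳ p)

/-- `Tor_p^R(N, M)`, as the homology of `N ⊗ F` for the standard graded free resolution `F`
of `M`. -/
abbrev GradedTor {R M : Type} (N : Type) [CommRing R] [Algebra ℚ R] (𝒜 : ℤ → Submodule ℚ R)
    [AddCommGroup N] [Module R N]
    [AddCommGroup M] [Module R M] [Module ℚ M] (ℳ : ℤ → Submodule ℚ M) (p : ℕ) : Type :=
  SubQuot (torCycles N 𝒜 ℳ p) (LinearMap.range (torBoundary (N := N) 𝒜 ℳ p))

/-- The homogeneous component `Tor_p^R(N, M)^q` of degree `q`. -/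
def torDeg {R N M : Type} [CommRing R] [Algebra ℚ R] (𝒜 : ℤ → Submodule ℚ R)
    [AddCommGroup N] [Module R N] [Module ℚ N] [IsScalarTower ℚ R N]
    [AddCommGroup M] [Module R M] [Module ℚ M]
    (𝒩 : ℤ → Submodule ℚ N) (ℳ : ℤ → Submodule ℚ M) (p : ℕ) (q : ℤ) :
    Submodule ℚ (GradedTor N 𝒜 ℳ p) :=
  SubQuot.part ℚ _ _ (tensorDeg 𝒩 (freeDeg 𝒜 (resolution 𝒜 ℳ p).deg) q)

/-- The grading of `R ⧸ I` induced by a grading of `R`. -/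
def quotDeg {R : Type} [CommRing R] [Algebra ℚ R] (𝒜 : ℤ → Submodule ℚ R) (I : Ideal R) (q : ℤ) :
    Submodule ℚ (R ⧸ I) :=
  (𝒜 q).map (Ideal.Quotient.mkₐ ℚ I).toLinearMap

/-- The Betti number `dim_ℚ Tor_p^R(R/I, M)^q` of a graded module `M`, as a cardinal. -/
def bettiNumber {R M : Type} [CommRing R] [Algebra ℚ R] (𝒜 : ℤ → Submodule ℚ R) (I : Ideal R)
    [AddCommGroup M] [Module R M] [Module ℚ M] (ℳ : ℤ → Submodule ℚ M) (p : ℕ) (q : ℤ) :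
    Cardinal.{0} :=
  Module.rank ℚ (torDeg 𝒜 (quotDeg 𝒜 I) ℳ p q)

/-! ### The grading of polynomial rings with variables of degree 2 -/

/-- The homogeneous polynomials of degree `n`, where every variable has degree `2`. -/
def polyDeg (V : Type) (n : ℤ) : Submodule ℚ (MvPolynomial V ℚ) :=
  MvPolynomial.weightedHomogeneousSubmodule ℚ (fun _ : V => (2 : ℤ)) n

/-- The subring `ℚ[X_v - X_w]` of `ℚ[X_v]` generated by the differences of the variables. -/
abbrev DiffRing (V : Type) : Subalgebra ℚ (MvPolynomial V ℚ) :=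
  Algebra.adjoin ℚ {f | ∃ v w : V, f = MvPolynomial.X v - MvPolynomial.X w}

/-- The element `X_v - X_w` of `ℚ[X_v - X_w]`. -/
def diffX {V : Type} (v w : V) : DiffRing V :=
  ⟨MvPolynomial.X v - MvPolynomial.X w, Algebra.subset_adjoin ⟨v, w, rfl⟩⟩

/-- The homogeneous elements of degree `n` in the subring generated by the differences. -/
def diffDeg (V : Type) (n : ℤ) : Submodule ℚ (DiffRing V) :=
  (polyDeg V n).comap (DiffRing V).val.toLinearMap

/-- The map `ℚ[X_v - X_w] → ℚ[X_a - X_b]` that sends `X_v - X_w` to `X_{e v} - X_{e w}`. -/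
def diffRename {V W : Type} (e : V → W) : DiffRing V →ₐ[ℚ] DiffRing W :=
  ((MvPolynomial.rename e).comp (DiffRing V).val).codRestrict (DiffRing W) (by
    rintro ⟨x, hx⟩
    have h : DiffRing V ≤ (DiffRing W).comap (MvPolynomial.rename (R := ℚ) e) := by
      refine Algebra.adjoin_le ?_
      rintro _ ⟨v, w, rfl⟩
      refine Algebra.subset_adjoin ⟨e v, e w, ?_⟩
      simp
    exact h hx)

/-! ### The cube of double complexes

For a crossing with horizontal coefficient `a` and vertical coefficient `b`, the double complex
of a positive crossing (on the left) and of a negative crossing (on the right) is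
```
  S{0,-2,0}   ----a--->  S{0,0,0}           S{0,-2,2}  --ab-->  S{-2,0,2}
     ^ b                    ^ 1                ^ 1                 ^ b
  S{2,-2,-2}  ---ab--->  S{0,0,-2}          S{0,-2,0}  ---a-->  S{0,0,0}
```
with horizontal differential `d_+` and vertical differential `d_v`.  A corner of the square
is a pair of booleans: `right` (`true` for the right column) and `top` (`true` for the top row).
The double complex of several crossings is the tensor product over `S`. -/

/-- The horizontal arrow of a crossing in the given row. -/
def coefH {S : Type} [CommRing S] (pos : Bool) (a b : S) (top : Bool) : S :=
  match pos, top with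
  | true, true => a
  | true, false => a * b
  | false, true => a * b
  | false, false => a

/-- The vertical arrow of a crossing in the given column. -/
def coefV {S : Type} [CommRing S] (pos : Bool) (b : S) (right : Bool) : S :=
  match pos, right with
  | true, true => 1
  | true, false => b
  | false, true => b
  | false, false => 1

/-- The first (polynomial) grading shift at a corner. -/
def shiftQ (pos right top : Bool) : ℤ :=
  match pos, right, top with
  | true, false, false => 2
  | false, true, true => -2
  | _, _, _ => 0

/-- The second (horizontal) grading of a corner. -/
def gradH (right : Bool) : ℤ := if right then 0 else -2

/-- The third (vertical) grading of a corner. -/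
def gradV (pos top : Bool) : ℤ :=
  match pos, top with
  | true, true => 0
  | true, false => -2
  | false, true => 2
  | false, false => 0

/-- The corners of the tensor product of the squares of `n` crossings: a column and a row for
each crossing. -/
abbrev Corner (n : ℕ) : Type := (Fin n → Bool) × (Fin n → Bool)

/-- The free `S`-module underlying the tensor product, with one basis element for each corner. -/
abbrev Cube (S : Type) (n : ℕ) : Type := Corner n → S

/-- The Koszul sign of the horizontal arrow at the crossing `c`. -/
def signH {S : Type} [CommRing S] {n : ℕ} (h : Fin n → Bool) (c : Fin n) : S :=
  ∏ c' : Fin n, if c' < c then (-1) ^ (gradH (h c') / 2).natAbs else 1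

/-- The Koszul sign of the vertical arrow at the crossing `c`. -/
def signV {S : Type} [CommRing S] {n : ℕ} (pos : Fin n → Bool) (v : Fin n → Bool) (c : Fin n) :
    S :=
  ∏ c' : Fin n, if c' < c then (-1) ^ (gradV (pos c') (v c') / 2).natAbs else 1

/-- The horizontal differential `d_+` of the tensor product: the component at the corner `s`
receives, from each crossing in the right column, the arrow from the left column. -/
def dPlus {S : Type} [CommRing S] {n : ℕ} (pos : Fin n → Bool) (a b : Fin n → S) :
    Cube S n →ₗ[S] Cube S n where
  toFun f s := ∑ c : Fin n, if s.1 c = true then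
    signH s.1 c * coefH (pos c) (a c) (b c) (s.2 c) * f (Function.update s.1 c false, s.2) else 0
  map_add' f g := by
    funext s
    simp only [Pi.add_apply, ← Finset.sum_add_distrib]
    refine Finset.sum_congr rfl fun c _ => ?_
    split_ifs <;> ring
  map_smul' r f := by
    funext s
    simp only [Pi.smul_apply, smul_eq_mul, RingHom.id_apply, Finset.mul_sum]
    refine Finset.sum_congr rfl fun c _ => ?_
    split_ifs <;> ring

/-- The vertical differential `d_v` of the tensor product. -/
def dV {S : Type} [CommRing S] {n : ℕ} (pos : Fin n → Bool) (b : Fin n → S) :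
    Cube S n →ₗ[S] Cube S n where
  toFun f s := ∑ c : Fin n, if s.2 c = true then
    signV pos s.2 c * coefV (pos c) (b c) (s.1 c) * f (s.1, Function.update s.2 c false) else 0
  map_add' f g := by
    funext s
    simp only [Pi.add_apply, ← Finset.sum_add_distrib]
    refine Finset.sum_congr rfl fun c _ => ?_
    split_ifs <;> ring
  map_smul' r f := by
    funext s
    simp only [Pi.smul_apply, smul_eq_mul, RingHom.id_apply, Finset.mul_sum]
    refine Finset.sum_congr rfl fun c _ => ?_
    split_ifs <;> ring

theorem dPlus_comp_dV {S : Type} [CommRing S] {n : ℕ} (pos : Fin n → Bool) (a b : Fin n → S) :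
    dPlus pos a b ∘ₗ dV pos b = dV pos b ∘ₗ dPlus pos a b := by
  apply LinearMap.ext
  intro f
  funext s
  obtain ⟨h, v⟩ := s
  change (∑ c : Fin n, if h c = true then signH h c * coefH (pos c) (a c) (b c) (v c) *
      (∑ c' : Fin n, if v c' = true then signV pos v c' *
        coefV (pos c') (b c') (Function.update h c false c') *
        f (Function.update h c false, Function.update v c' false) else 0) else 0) =
    ∑ c' : Fin n, if v c' = true then signV pos v c' * coefV (pos c') (b c') (h c') *
      (∑ c : Fin n, if h c = true then signH h c *
        coefH (pos c) (a c) (b c) (Function.update v c' false c) *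
        f (Function.update h c false, Function.update v c' false) else 0) else 0
  have push : ∀ (P : Prop) [Decidable P] (x : S) (y : Fin n → S),
      (if P then x * ∑ i, y i else 0) = ∑ i, if P then x * y i else 0 := by
    intro P _ x y
    split_ifs
    · rw [Finset.mul_sum]
    · simp
  simp only [push]
  rw [Finset.sum_comm]
  refine Finset.sum_congr rfl fun c' _ => Finset.sum_congr rfl fun c _ => ?_
  by_cases hc : h c = true
  · by_cases hv : v c' = true
    · simp only [hc, hv, if_true]
      by_cases hcc : c = c'
      · subst hcc
        simp only [Function.update_self, hc, hv]
        cases pos c <;> simp only [coefH, coefV] <;> ring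
      · rw [Function.update_of_ne (Ne.symm hcc), Function.update_of_ne hcc]
        ring
    · simp [hv]
  · simp [hc]

/-- The component of second and third degree `(j, k)` of the cube, an `S`-submodule. -/
def cubeBideg {S : Type} [CommRing S] {n : ℕ} (pos : Fin n → Bool) (j k : ℤ) :
    Submodule S (Cube S n) where
  carrier := {f | ∀ s : Corner n,
    ¬ (∑ c, gradH (s.1 c) = j ∧ ∑ c, gradV (pos c) (s.2 c) = k) → f s = 0}
  add_mem' := fun hf hg s hs => by rw [Pi.add_apply, hf s hs, hg s hs, add_zero]
  zero_mem' := fun _ _ => rfl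
  smul_mem' := fun r f hf s hs => by rw [Pi.smul_apply, hf s hs, smul_zero]

/-- The homogeneous component of degree `(i, j, k)` of the cube over a graded ring `S`. -/
def cubeDeg {S : Type} [CommRing S] [Algebra ℚ S] (𝒮 : ℤ → Submodule ℚ S) {n : ℕ}
    (pos : Fin n → Bool) (i j k : ℤ) : Submodule ℚ (Cube S n) where
  carrier := {f | f ∈ cubeBideg (S := S) pos j k ∧
    ∀ s : Corner n, f s ∈ 𝒮 (i - ∑ c, shiftQ (pos c) (s.1 c) (s.2 c))}
  add_mem' := fun hf hg => ⟨(cubeBideg pos j k).add_mem hf.1 hg.1,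
    fun s => (𝒮 _).add_mem (hf.2 s) (hg.2 s)⟩
  zero_mem' := ⟨(cubeBideg pos j k).zero_mem, fun _ => (𝒮 _).zero_mem⟩
  smul_mem' := fun r f hf => ⟨fun s hs => by rw [Pi.smul_apply, hf.1 s hs, smul_zero],
    fun s => (𝒮 _).smul_mem r (hf.2 s)⟩

/-- The differential induced by `d_v` on the homology of the cube with respect to `d_+`. -/
def dVInd {S : Type} [CommRing S] {n : ℕ} (pos : Fin n → Bool) (a b : Fin n → S) :
    Homology (dPlus pos a b) →ₗ[S] Homology (dPlus pos a b) :=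
  Homology.induced (dPlus pos a b) (dV pos b) (dPlus_comp_dV pos a b)

/-- The iterated homology `H(H(C, d_+), d_v)` of the cube. -/
abbrev CubeHomology {S : Type} [CommRing S] {n : ℕ} (pos : Fin n → Bool) (a b : Fin n → S) :
    Type :=
  Homology (dVInd pos a b)

/-- The component of second and third degree `(j, k)` of the iterated homology. -/
def homologyBideg {S : Type} [CommRing S] {n : ℕ} (pos : Fin n → Bool) (a b : Fin n → S)
    (j k : ℤ) : Submodule S (CubeHomology pos a b) :=
  SubQuot.part S _ _ (SubQuot.part S _ _ (cubeBideg pos j k))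

/-- The component of degree `(i, j, k)` of the iterated homology. -/
def homologyDeg {S : Type} [CommRing S] [Algebra ℚ S] (𝒮 : ℤ → Submodule ℚ S) {n : ℕ}
    (pos : Fin n → Bool) (a b : Fin n → S) (i j k : ℤ) : Submodule ℚ (CubeHomology pos a b) :=
  SubQuot.part ℚ _ _ (SubQuot.part ℚ _ _ (cubeDeg 𝒮 pos i j k))

/-! ### Closed braids -/

/-- A closed braid on `N + 1` strands, given by a braid word of length `len`: its letters are
`σ_{gen 0}^{±1}, σ_{gen 1}^{±1}, …`, where `pos t = true` means the exponent `+1`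
(a positive crossing) and `pos t = false` the exponent `-1`. -/
structure ClosedBraid where
  N : ℕ
  len : ℕ
  gen : Fin len → Fin N
  pos : Fin len → Bool

namespace ClosedBraid

/-- The pieces of the strands: `(p, t)` is the piece at position `p` right below the `t`-th
crossing, and right above the preceding one; `t = len` is the top of the braid. -/
abbrev Segment (B : ClosedBraid) : Type := Fin (B.N + 1) × Fin (B.len + 1)

/-- Two pieces of strands are adjacent without a crossing between them: either the strand passes
beside the crossing `t`, or the pieces are joined by closing up the braid. -/
def Adjacent (B : ClosedBraid) (x y : B.Segment) : Prop :=
  (∃ (p : Fin (B.N + 1)) (t : Fin B.len), p ≠ (B.gen t).castSucc ∧ p ≠ (B.gen t).succ ∧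
    x = (p, t.castSucc) ∧ y = (p, t.succ)) ∨
  ∃ p : Fin (B.N + 1), x = (p, Fin.last B.len) ∧ y = (p, 0)

/-- The edges of the closed braid.  (A strand without crossings closes up to a single edge.) -/
def Edge (B : ClosedBraid) : Type := Quot B.Adjacent

/-- The left edge pointing into a crossing. -/
def inL (B : ClosedBraid) (t : Fin B.len) : B.Edge := Quot.mk _ ((B.gen t).castSucc, t.castSucc)

/-- The right edge pointing into a crossing. -/
def inR (B : ClosedBraid) (t : Fin B.len) : B.Edge := Quot.mk _ ((B.gen t).succ, t.castSucc)

/-- The left edge pointing out of a crossing. -/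
def outL (B : ClosedBraid) (t : Fin B.len) : B.Edge := Quot.mk _ ((B.gen t).castSucc, t.succ)

/-- The right edge pointing out of a crossing. -/
def outR (B : ClosedBraid) (t : Fin B.len) : B.Edge := Quot.mk _ ((B.gen t).succ, t.succ)

/-- The components of the closed braid: a strand goes straight through each crossing, from the
lower left to the upper right or from the lower right to the upper left. -/
def Component (B : ClosedBraid) : Type :=
  Quot fun x y : B.Edge => ∃ t : Fin B.len,
    (x = B.inL t ∧ y = B.outR t) ∨ (x = B.inR t ∧ y = B.outL t)

/-- The component on which an edge lies. -/
def component (B : ClosedBraid) (x : B.Edge) : B.Component := Quot.mk _ x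

/-- A closed braid is a knot if it has exactly one component. -/
def IsKnot (B : ClosedBraid) : Prop := Nat.card B.Component = 1

/-- The writhe. -/
def writhe (B : ClosedBraid) : ℤ := ∑ t, if B.pos t then 1 else -1

/-- The number of strands. -/
def strands (B : ClosedBraid) : ℤ := B.N + 1

/-! ### The edge ring and the middle HOMFLYPT homology `H(B)` -/

/-- The relation `X_k + X_l - X_i - X_j` of a crossing, written as a sum of differences. -/
def rho (B : ClosedBraid) (t : Fin B.len) : DiffRing B.Edge :=
  diffX (B.outL t) (B.inL t) + diffX (B.outR t) (B.inR t)

/-- The ideal of `ℚ[X_1, …, X_M]` generated by the relations of the crossings. -/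
def relIdeal (B : ClosedBraid) : Ideal (MvPolynomial B.Edge ℚ) :=
  Ideal.span (Set.range fun t => (B.rho t : MvPolynomial B.Edge ℚ))

/-- The edge ring `R(B)`. -/
def EdgeRing (B : ClosedBraid) : Type := MvPolynomial B.Edge ℚ ⧸ B.relIdeal

instance (B : ClosedBraid) : CommRing B.EdgeRing :=
  inferInstanceAs (CommRing (MvPolynomial B.Edge ℚ ⧸ B.relIdeal))

instance (B : ClosedBraid) : Algebra ℚ B.EdgeRing :=
  inferInstanceAs (Algebra ℚ (MvPolynomial B.Edge ℚ ⧸ B.relIdeal))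

/-- The quotient map from the polynomial ring to the edge ring. -/
def toEdgeRing (B : ClosedBraid) : MvPolynomial B.Edge ℚ →ₐ[ℚ] B.EdgeRing :=
  Ideal.Quotient.mkₐ ℚ B.relIdeal

/-- The grading of the edge ring. -/
def edgeRingDeg (B : ClosedBraid) (n : ℤ) : Submodule ℚ B.EdgeRing :=
  (polyDeg B.Edge n).map B.toEdgeRing.toLinearMap

/-- The coefficient `X_k - X_i`, where `k` is the left outgoing and `i` the left incoming edge. -/
def coefA (B : ClosedBraid) (t : Fin B.len) : DiffRing B.Edge := diffX (B.outL t) (B.inL t)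

/-- The coefficient `X_l - X_i`, where `l` is the right outgoing and `i` the left incoming edge. -/
def coefB (B : ClosedBraid) (t : Fin B.len) : DiffRing B.Edge := diffX (B.outR t) (B.inL t)

/-- The coefficients `coefA` in the edge ring. -/
def edgeA (B : ClosedBraid) (t : Fin B.len) : B.EdgeRing :=
  B.toEdgeRing (B.coefA t : MvPolynomial B.Edge ℚ)

/-- The coefficients `coefB` in the edge ring. -/
def edgeB (B : ClosedBraid) (t : Fin B.len) : B.EdgeRing :=
  B.toEdgeRing (B.coefB t : MvPolynomial B.Edge ℚ)

/-- The iterated homology `H(H(C_0(B), d_+), d_v)`, before the grading shift. -/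
abbrev MiddleHomology (B : ClosedBraid) : Type := CubeHomology B.pos B.edgeA B.edgeB

/-- The `R(B)`-module `H^{⋆,j,k}(B)`, where
`H(B) = H(H(C_0(B), d_+), d_v){-w+b, w+b-1, w-b+1}`. -/
def H (B : ClosedBraid) (j k : ℤ) : Submodule B.EdgeRing B.MiddleHomology :=
  homologyBideg B.pos B.edgeA B.edgeB
    (j - (B.writhe + B.strands - 1)) (k - (B.writhe - B.strands + 1))

/-- The homogeneous component `H^{i,j,k}(B)` in `H^{⋆,j,k}(B)`. -/
def HDeg (B : ClosedBraid) (j k i : ℤ) : Submodule ℚ (B.H j k) :=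
  (homologyDeg B.edgeRingDeg B.pos B.edgeA B.edgeB
    (i - (-B.writhe + B.strands)) (j - (B.writhe + B.strands - 1))
    (k - (B.writhe - B.strands + 1))).comap ((B.H j k).subtype.restrictScalars ℚ)

/-! ### The reduction `H_r(B)` -/

/-- The ideal of `ℚ[X_k - X_l]` generated by the relations of the crossings. -/
def reducedRelIdeal (B : ClosedBraid) : Ideal (DiffRing B.Edge) := Ideal.span (Set.range B.rho)

/-- The reduced edge ring `R_r(B)`: the quotient of the ring generated by the differences of the
variables by the relations of the crossings. -/
def ReducedEdgeRing (B : ClosedBraid) : Type := DiffRing B.Edge ⧸ B.reducedRelIdeal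

instance (B : ClosedBraid) : CommRing B.ReducedEdgeRing :=
  inferInstanceAs (CommRing (DiffRing B.Edge ⧸ B.reducedRelIdeal))

instance (B : ClosedBraid) : Algebra ℚ B.ReducedEdgeRing :=
  inferInstanceAs (Algebra ℚ (DiffRing B.Edge ⧸ B.reducedRelIdeal))

/-- The quotient map onto the reduced edge ring. -/
def toReducedEdgeRing (B : ClosedBraid) : DiffRing B.Edge →ₐ[ℚ] B.ReducedEdgeRing :=
  Ideal.Quotient.mkₐ ℚ B.reducedRelIdeal

/-- The grading of the reduced edge ring. -/
def reducedEdgeRingDeg (B : ClosedBraid) (n : ℤ) : Submodule ℚ B.ReducedEdgeRing :=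
  (diffDeg B.Edge n).map B.toReducedEdgeRing.toLinearMap

/-- The coefficients `coefA` in the reduced edge ring. -/
def redA (B : ClosedBraid) (t : Fin B.len) : B.ReducedEdgeRing :=
  B.toReducedEdgeRing (B.coefA t)

/-- The coefficients `coefB` in the reduced edge ring. -/
def redB (B : ClosedBraid) (t : Fin B.len) : B.ReducedEdgeRing :=
  B.toReducedEdgeRing (B.coefB t)

/-- The iterated homology `H(H(C_r(B), d_+), d_v)`, before the grading shift. -/
abbrev ReductionHomology (B : ClosedBraid) : Type := CubeHomology B.pos B.redA B.redB

/-- The `R_r(B)`-module `H_r^{⋆,j,k}(B)`, where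
`H_r(B) = H(H(C_r(B), d_+), d_v){-w+b-1, w+b-1, w-b+1}`. -/
def Hr (B : ClosedBraid) (j k : ℤ) : Submodule B.ReducedEdgeRing B.ReductionHomology :=
  homologyBideg B.pos B.redA B.redB
    (j - (B.writhe + B.strands - 1)) (k - (B.writhe - B.strands + 1))

/-- The homogeneous component `H_r^{i,j,k}(B)` in `H_r^{⋆,j,k}(B)`. -/
def HrDeg (B : ClosedBraid) (j k i : ℤ) : Submodule ℚ (B.Hr j k) :=
  (homologyDeg B.reducedEdgeRingDeg B.pos B.redA B.redB
    (i - (-B.writhe + B.strands - 1)) (j - (B.writhe + B.strands - 1))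
    (k - (B.writhe - B.strands + 1))).comap ((B.Hr j k).subtype.restrictScalars ℚ)

/-! ### Betti numbers

`R_B = ℚ[X_K | K a component]` acts on `H(B)` with `X_K` acting as the variable of an edge on `K`,
and `R_{B,r}`, the subring generated by the differences, acts on `H_r(B)` in the same way.
The edge `e K` on each component `K` is a parameter below. -/

/-- The ring homomorphism `R_B → R(B)` that sends `X_K` to the variable of the edge `e K`. -/
def actionMap (B : ClosedBraid) (e : B.Component → B.Edge) :
    MvPolynomial B.Component ℚ →ₐ[ℚ] B.EdgeRing :=
  B.toEdgeRing.comp (MvPolynomial.rename e)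

/-- The ring homomorphism `R_{B,r} → R_r(B)` that sends `X_K - X_L` to the difference of the
variables of the edges `e K` and `e L`. -/
def reducedActionMap (B : ClosedBraid) (e : B.Component → B.Edge) :
    DiffRing B.Component →ₐ[ℚ] B.ReducedEdgeRing :=
  B.toReducedEdgeRing.comp (diffRename e)

/-- The Betti number `β_B(p,q,j,k) = dim_ℚ Tor_p^{R_B}(R_B/𝔪, H^{⋆,j,k}(B))^q`, with `𝔪` generated
by the variables. -/
def betti (B : ClosedBraid) (e : B.Component → B.Edge) (p : ℕ) (q j k : ℤ) : Cardinal.{0} :=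
  letI : Module (MvPolynomial B.Component ℚ) (B.H j k) :=
    Module.compHom _ (B.actionMap e).toRingHom
  bettiNumber (polyDeg B.Component) (Ideal.span (Set.range MvPolynomial.X)) (B.HDeg j k) p q

/-- The Betti number `β_{B,r}(p,q,j,k) = dim_ℚ Tor_p^{R_{B,r}}(R_{B,r}/𝔪_r, H_r^{⋆,j,k}(B))^q`, with
`𝔪_r` generated by the differences of the variables. -/
def bettiReduced (B : ClosedBraid) (e : B.Component → B.Edge) (p : ℕ) (q j k : ℤ) :
    Cardinal.{0} :=
  letI : Module (DiffRing B.Component) (B.Hr j k) :=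
    Module.compHom _ (B.reducedActionMap e).toRingHom
  bettiNumber (diffDeg B.Component)
    (Ideal.span {f | ∃ K L : B.Component, f = diffX K L}) (B.HrDeg j k) p q

/-! ### The reduced HOMFLYPT homology of a knot

For a connected diagram, such as any closed braid diagram of a knot, the reduced HOMFLYPT homology
is the homology of the quotient complex `C_0(B) / X_x C_0(B)` for a marked edge `x`, that is, of
the cube over the ring `R(B) / (X_x)`. -/

/-- The ideal `(X_x)` of the edge ring. -/
def markedIdeal (B : ClosedBraid) (x : B.Edge) : Ideal B.EdgeRing :=
  Ideal.span {B.toEdgeRing (MvPolynomial.X x)}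

/-- The ring `R(B) / (X_x)`. -/
def MarkedEdgeRing (B : ClosedBraid) (x : B.Edge) : Type := B.EdgeRing ⧸ B.markedIdeal x

instance (B : ClosedBraid) (x : B.Edge) : CommRing (B.MarkedEdgeRing x) :=
  inferInstanceAs (CommRing (B.EdgeRing ⧸ B.markedIdeal x))

instance (B : ClosedBraid) (x : B.Edge) : Algebra ℚ (B.MarkedEdgeRing x) :=
  inferInstanceAs (Algebra ℚ (B.EdgeRing ⧸ B.markedIdeal x))

/-- The quotient map from the edge ring. -/
def toMarkedEdgeRing (B : ClosedBraid) (x : B.Edge) : B.EdgeRing →ₐ[ℚ] B.MarkedEdgeRing x :=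
  Ideal.Quotient.mkₐ ℚ (B.markedIdeal x)

/-- The grading of `R(B) / (X_x)`. -/
def markedEdgeRingDeg (B : ClosedBraid) (x : B.Edge) (n : ℤ) : Submodule ℚ (B.MarkedEdgeRing x) :=
  (B.edgeRingDeg n).map (B.toMarkedEdgeRing x).toLinearMap

/-- The coefficients `coefA` modulo `X_x`. -/
def markedA (B : ClosedBraid) (x : B.Edge) (t : Fin B.len) : B.MarkedEdgeRing x :=
  B.toMarkedEdgeRing x (B.edgeA t)

/-- The coefficients `coefB` modulo `X_x`. -/
def markedB (B : ClosedBraid) (x : B.Edge) (t : Fin B.len) : B.MarkedEdgeRing x :=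
  B.toMarkedEdgeRing x (B.edgeB t)

/-- The homogeneous component of degree `(i, j, k)` of the homology
`H(H(C_0(B) / X_x C_0(B), d_+), d_v){-w+b-1, w+b-1, w-b+1}`. -/
def HbarDeg (B : ClosedBraid) (x : B.Edge) (i j k : ℤ) :
    Submodule ℚ (CubeHomology B.pos (B.markedA x) (B.markedB x)) :=
  homologyDeg (B.markedEdgeRingDeg x) B.pos (B.markedA x) (B.markedB x)
    (i - (-B.writhe + B.strands - 1)) (j - (B.writhe + B.strands - 1))
    (k - (B.writhe - B.strands + 1))

end ClosedBraid

end

end HOMFLYPT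

/-! The ring `ℚ[X_v]` is a polynomial ring in one variable `X_{v₀}` over its subring generated by
differences, for any choice of `v₀`. The relations of the crossings lie in that subring, so the edge
ring is likewise `R(B) = R_r(B)[X_{v₀}]`, a graded free extension with basis `1, X_{v₀}, X_{v₀}², …`
(`freeExtension_edgeRing`). The arrows of the cube also have coefficients in `R_r(B)`. Hence the
cube over `R(B)` is the direct sum of the translates by `X_{v₀}^n` of the cube over `R_r(B)`, and
both differentials respect this sum. Kernels, images and quotients inherit it, so `H = ⨁ X_{v₀}^n
H_r`; the two normalizations of the first grading account for the shift by one.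

Now let `v₀` be the chosen edge on a component `K₀`. Then `X_{v₀}` is the action of `X_{K₀}`, and
`R_B = R_{B,r}[X_{K₀}]`, so `H` is the extension of scalars of `H_r` from `R_{B,r}` to `R_B`, up to
the shift. A graded free resolution of `H_r` extends to one of `H` with the same generators, and
modulo the augmentation ideals both reduce to the same complex of rational vector spaces. Since
Betti numbers may be computed from any graded free resolution (`bettiNumber_eq_redRank`), they agree
(`bettiNumber_eq_of_freeExtension`).

For a knot, `R_{B,r}` is just `ℚ`. Bases of the homogeneous components of `H_r` give a resolution of
length zero, so Tor is `H_r` in homological degree zero and vanishes above. Killing `X_x` in `R(B) =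
R_r(B)[X_x]` gives back `R_r(B)`, which identifies `H_r` with the reduced homology.

Extension of scalars is handled without tensor products, through coordinates: `Decomposes` says that
every element of `W` is uniquely a finite sum of terms `t k (v k)`, and `DecomposesTo` that a subset
of `W` is described by conditions on the coordinates. Homogeneous components are arbitrary families
of subspaces; it is never needed that they span the module or are independent, and resolutions are
exact only on homogeneous elements. -/

namespace HOMFLYPT

noncomputable section

/-! ### Decompositions `W = ⨁ₖ tₖ(V)` -/

section Decomposition

variable {κ V W V₁ W₁ : Type} [AddCommGroup V] [AddCommGroup W] [AddCommGroup V₁] [AddCommGroup W₁]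

/-- The map `⨁ₖ V → W` with components `t k`. -/
def assemble (t : κ → V →+ W) : (κ →₀ V) →+ W := Finsupp.liftAddHom t

theorem assemble_single (t : κ → V →+ W) (k : κ) (v : V) :
    assemble t (Finsupp.single k v) = t k v := by
  simp [assemble]

theorem map_assemble {t : κ → V →+ W} {t₁ : κ → V₁ →+ W₁} {f : V →+ V₁} {g : W →+ W₁}
    (h : ∀ k v, g (t k v) = t₁ k (f v)) (v : κ →₀ V) :
    g (assemble t v) = assemble t₁ (Finsupp.mapRange.addMonoidHom f v) := by
  induction v using Finsupp.induction_linear with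
  | zero => simp
  | add a b ha hb => simp only [map_add, ha, hb]
  | single k a => simp [assemble_single, h]

theorem assemble_mem {t : κ → V →+ W} {N : κ → Set V} {A : Type} [SetLike A W]
    [AddSubmonoidClass A W] {N' : A} (h : ∀ k, ∀ v ∈ N k, t k v ∈ N') (v : κ →₀ V)
    (hv : ∀ k, v k ∈ N k) : assemble t v ∈ N' := by
  simp only [assemble, Finsupp.liftAddHom_apply, Finsupp.sum]
  exact sum_mem fun k _ => h k _ (hv k)

/-- `W` is the direct sum of copies of `V`, embedded by the maps `t k`. -/
def Decomposes (t : κ → V →+ W) : Prop := Function.Bijective (assemble t)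

/-- In terms of the maps `t k`, the subset `N'` consists of the sums of elements of the `N k`. -/
structure DecomposesTo (t : κ → V →+ W) (N : κ → Set V) (N' : Set W) : Prop where
  mem : ∀ k, ∀ v ∈ N k, t k v ∈ N'
  exists_eq : ∀ w ∈ N', ∃ v : κ →₀ V, (∀ k, v k ∈ N k) ∧ assemble t v = w

theorem exists_finsupp_lift (f : V →+ V₁) (N : κ → Set V) (h0 : ∀ k, (0 : V) ∈ N k) (y : κ →₀ V₁)
    (h : ∀ k, ∃ z ∈ N k, f z = y k) :
    ∃ z : κ →₀ V, (∀ k, z k ∈ N k) ∧ Finsupp.mapRange.addMonoidHom f z = y := by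
  classical
  choose z hz hfz using h
  -- A chosen preimage of `0` need not be `0`. Resetting it to `0` off the support of `y` keeps the
  -- lift finitely supported; this is where `0 ∈ N k` enters.
  refine ⟨Finsupp.onFinset y.support (fun k => if y k = 0 then 0 else z k) ?_, ?_, ?_⟩
  · intro k hk
    rw [Finsupp.mem_support_iff]
    intro h
    simp [h] at hk
  · intro k
    simp only [Finsupp.onFinset_apply]
    split_ifs
    exacts [h0 k, hz k]
  · ext k
    simp only [Finsupp.mapRange.addMonoidHom_apply, Finsupp.mapRange_apply,
      Finsupp.onFinset_apply]
    split_ifs with h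
    · simp [h]
    · exact hfz k

variable {t : κ → V →+ W} {t₁ : κ → V₁ →+ W₁}

/-- Coordinates are unique, so those supplied by `DecomposesTo` are the given ones. -/
theorem Decomposes.mem_of_assemble_mem (ht : Decomposes t) {N : κ → Set V} {N' : Set W}
    (h : DecomposesTo t N N') {v : κ →₀ V} (hv : assemble t v ∈ N') (k : κ) : v k ∈ N k := by
  obtain ⟨u, hu, huv⟩ := h.exists_eq _ hv
  rw [← ht.1 huv]
  exact hu k

theorem Decomposes.univ (ht : Decomposes t) : DecomposesTo t (fun _ => Set.univ) Set.univ where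
  mem _ _ _ := trivial
  exists_eq w _ := by
    obtain ⟨v, hv⟩ := ht.2 w
    exact ⟨v, fun _ => trivial, hv⟩

theorem decomposesTo_zero (t : κ → V →+ W) : DecomposesTo t (fun _ => {0}) {0} where
  mem := by simp
  exists_eq := by
    rintro w rfl
    exact ⟨0, by simp, by simp⟩

/-! ### Decompositions of subobjects. -/

section Sub

variable (ht : Decomposes t) {i : V₁ →+ V} {i' : W₁ →+ W} (hi : Function.Injective i)
  (hi' : Function.Injective i') (hc : ∀ k v, i' (t₁ k v) = t k (i v))
  (hr : DecomposesTo t (fun _ => Set.range i) (Set.range i'))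

include ht hi' hc hr in
-- The image in `W` of an element of `W₁` has coordinates coming from `V₁` by `hr`, and these lie in
-- `N` by uniqueness. Lifting them along `i` gives coordinates in `W₁`.
theorem DecomposesTo.preimage {N : κ → Set V} {N' : Set W} (h : DecomposesTo t N N')
    (h0 : ∀ k, (0 : V) ∈ N k) :
    DecomposesTo t₁ (fun k => i ⁻¹' N k) (i' ⁻¹' N') where
  mem k v hv := by
    change i' _ ∈ N'
    rw [hc]
    exact h.mem k _ hv
  exists_eq w hw := by
    obtain ⟨v, hv, hvw⟩ := hr.exists_eq (i' w) ⟨w, rfl⟩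
    have hN : ∀ k, v k ∈ N k := ht.mem_of_assemble_mem h (by rw [hvw]; exact hw)
    obtain ⟨z, hz, hzv⟩ := exists_finsupp_lift i (fun k => i ⁻¹' N k)
      (fun k => by simpa using h0 k) v (fun k => by
        obtain ⟨a, ha⟩ := hv k
        exact ⟨a, by simpa [ha] using hN k, ha⟩)
    refine ⟨z, hz, hi' ?_⟩
    rw [map_assemble hc, hzv, hvw]

include ht hi hi' hc hr in
theorem Decomposes.of_injective : Decomposes t₁ := by
  refine ⟨(injective_iff_map_eq_zero _).2 fun v hv => ?_, fun w => ?_⟩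
  · have h := map_assemble hc v
    rw [hv, map_zero] at h
    have h1 := (injective_iff_map_eq_zero _).1 ht.1 _ h.symm
    ext k
    have := DFunLike.congr_fun h1 k
    simp only [Finsupp.mapRange.addMonoidHom_apply, Finsupp.mapRange_apply,
      Finsupp.coe_zero, Pi.zero_apply] at this
    exact (map_eq_zero_iff i hi).1 this
  · obtain ⟨v, -, hv⟩ := (DecomposesTo.preimage ht hi' hc hr ht.univ (fun _ => trivial)).exists_eq w
      trivial
    exact ⟨v, hv⟩

end Sub

/-! ### Decompositions of quotients. -/

section Quotient

variable {π : V →+ V₁} {π' : W →+ W₁} (hc : ∀ k v, π' (t k v) = t₁ k (π v))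

include hc in
theorem DecomposesTo.image {N : κ → Set V} {N' : Set W} (h : DecomposesTo t N N') :
    DecomposesTo t₁ (fun k => π '' N k) (π' '' N') where
  mem := by
    rintro k _ ⟨v, hv, rfl⟩
    exact ⟨t k v, h.mem k v hv, hc k v⟩
  exists_eq := by
    rintro _ ⟨w, hw, rfl⟩
    obtain ⟨v, hv, rfl⟩ := h.exists_eq w hw
    exact ⟨Finsupp.mapRange.addMonoidHom π v, fun k => ⟨v k, hv k, by simp⟩,
      (map_assemble hc v).symm⟩

include hc in
-- Uniqueness downstairs: lift the coordinates; if the sum dies in `W₁`, it lies in the kernel of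
-- `π'`, which is described coordinatewise, so each coordinate dies in `V₁`.
theorem Decomposes.of_surjective (ht : Decomposes t) (hπ : Function.Surjective π)
    (hπ' : Function.Surjective π')
    (hker : DecomposesTo t (fun _ => {v | π v = 0}) {w | π' w = 0}) : Decomposes t₁ := by
  refine ⟨(injective_iff_map_eq_zero _).2 fun v hv => ?_, fun w => ?_⟩
  · obtain ⟨z, -, rfl⟩ := exists_finsupp_lift π (fun _ => Set.univ) (fun _ => trivial) v
      (fun k => by simpa using hπ (v k))
    rw [← map_assemble hc] at hv
    ext k
    simpa using ht.mem_of_assemble_mem hker hv k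
  · obtain ⟨w, rfl⟩ := hπ' w
    obtain ⟨v, rfl⟩ := ht.2 w
    exact ⟨_, (map_assemble hc v).symm⟩

end Quotient

/-- A map commuting with the embeddings acts on each coordinate separately, and coordinates in the
target are unique. -/
theorem Decomposes.ker (ht : Decomposes t) (ht₁ : Decomposes t₁) {d : V →+ V₁} {d' : W →+ W₁}
    (hd : ∀ k v, d' (t k v) = t₁ k (d v)) :
    DecomposesTo t (fun _ => {v | d v = 0}) {w | d' w = 0} where
  mem k v hv := by
    simp only [Set.mem_ofPred_eq] at hv ⊢
    rw [hd, hv, map_zero]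
  exists_eq w hw := by
    obtain ⟨v, rfl⟩ := ht.2 w
    refine ⟨v, fun k => ?_, rfl⟩
    rw [Set.mem_ofPred_eq, map_assemble hd] at hw
    have := DFunLike.congr_fun ((injective_iff_map_eq_zero _).1 ht₁.1 _ hw) k
    simpa using this

theorem Decomposes.range (ht : Decomposes t) {d : V →+ V₁} {d' : W →+ W₁}
    (hd : ∀ k v, d' (t k v) = t₁ k (d v)) :
    DecomposesTo t₁ (fun _ => Set.range d) (Set.range d') := by
  simpa only [Set.image_univ] using ht.univ.image hd

/-- The decomposition of a sum of copies of `W`. -/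
def finsuppMaps (ι : Type) (t : κ → V →+ W) (k : κ) : (ι →₀ V) →+ (ι →₀ W) :=
  Finsupp.mapRange.addMonoidHom (t k)

theorem assemble_finsuppMaps_apply {ι : Type} (v : κ →₀ (ι →₀ V)) (b : ι) :
    assemble (finsuppMaps ι t) v b =
      assemble t (Finsupp.mapRange.addMonoidHom (Finsupp.applyAddHom b) v) :=
  map_assemble (t := finsuppMaps ι t) (t₁ := t) (f := Finsupp.applyAddHom b)
    (g := Finsupp.applyAddHom b) (fun _ _ => rfl) v

theorem DecomposesTo.finsupp {ι : Type} {N : ι → κ → Set V} {N' : ι → Set W}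
    (h : ∀ b, DecomposesTo t (N b) (N' b)) (h0 : ∀ b k, (0 : V) ∈ N b k) :
    DecomposesTo (finsuppMaps ι t) (fun k => {f | ∀ b, f b ∈ N b k}) {f | ∀ b, f b ∈ N' b} where
  mem k v hv b := (h b).mem k _ (hv b)
  exists_eq w hw := by
    classical
    choose u hu huw using fun b => (h b).exists_eq _ (hw b)
    -- Transposition: each entry `w b` has its own coordinates `u b`, which are placed at position
    -- `b`. Summing over the support of `w` keeps everything finite.
    refine ⟨∑ b ∈ w.support, Finsupp.mapRange.addMonoidHom (Finsupp.singleAddHom b) (u b),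
      fun k b => ?_, ?_⟩
    · simp only [Finsupp.coe_finsetSum, Finset.sum_apply, Finsupp.mapRange.addMonoidHom_apply,
        Finsupp.mapRange_apply, Finsupp.singleAddHom_apply, Finsupp.single_apply,
        Finset.sum_ite_eq']
      split_ifs
      exacts [hu b k, h0 b k]
    · have h1 : ∀ b, assemble (finsuppMaps ι t)
          (Finsupp.mapRange.addMonoidHom (Finsupp.singleAddHom b) (u b)) =
          Finsupp.single b (w b) := by
        intro b
        rw [← map_assemble (g := Finsupp.singleAddHom b) (t := t)
          (fun k v => by simp [finsuppMaps]), huw]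
        simp
      rw [map_sum, Finset.sum_congr rfl fun b _ => h1 b]
      exact Finsupp.sum_single w

theorem Decomposes.finsupp (ι : Type) (ht : Decomposes t) : Decomposes (finsuppMaps ι t) := by
  refine ⟨(injective_iff_map_eq_zero _).2 fun v hv => ?_, fun w => ?_⟩
  · ext k b
    have h := assemble_finsuppMaps_apply (t := t) v b
    rw [hv, Finsupp.zero_apply] at h
    have := DFunLike.congr_fun ((injective_iff_map_eq_zero _).1 ht.1 _ h.symm) k
    simpa using this
  · obtain ⟨v, -, hv⟩ := (DecomposesTo.finsupp (ι := ι) (fun _ => ht.univ)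
      (fun _ _ => trivial)).exists_eq w (fun _ => trivial)
    exact ⟨v, hv⟩

/-- The decomposition of a product of copies of `W`. -/
def piMaps (ι : Type) (t : κ → V →+ W) (k : κ) : (ι → V) →+ (ι → W) := (t k).compLeft ι

section Pi

variable {ι : Type} [Finite ι]

theorem DecomposesTo.pi {N : ι → κ → Set V} {N' : ι → Set W}
    (h : ∀ b, DecomposesTo t (N b) (N' b)) (h0 : ∀ b k, (0 : V) ∈ N b k) :
    DecomposesTo (piMaps ι t) (fun k => {f | ∀ b, f b ∈ N b k}) {f | ∀ b, f b ∈ N' b} where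
  mem k v hv b := (h b).mem k _ (hv b)
  exists_eq w hw := by
    obtain ⟨v, hv, hvw⟩ := (DecomposesTo.finsupp h h0).exists_eq (Finsupp.equivFunOnFinite.symm w) hw
    refine ⟨Finsupp.mapRange.addMonoidHom Finsupp.coeFnAddHom v, fun k b => ?_, ?_⟩
    · simpa using hv k b
    · rw [← map_assemble (g := Finsupp.coeFnAddHom) (t := finsuppMaps ι t) (fun k v => by rfl), hvw]
      rfl

/-- On a finite index set all functions are finitely supported, which reduces the claim to
`Decomposes.finsupp`. -/
theorem Decomposes.pi (ι : Type) [Finite ι] (ht : Decomposes t) : Decomposes (piMaps ι t) := by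
  refine (ht.finsupp ι).of_surjective (π := Finsupp.coeFnAddHom) (π' := Finsupp.coeFnAddHom)
    (fun k v => rfl) (fun w => ⟨Finsupp.equivFunOnFinite.symm w, rfl⟩)
    (fun w => ⟨Finsupp.equivFunOnFinite.symm w, rfl⟩) ?_
  have h : ∀ U : Type, [AddCommGroup U] →
      {f : ι →₀ U | Finsupp.coeFnAddHom f = 0} = ({0} : Set (ι →₀ U)) := by
    intro U _
    ext f
    exact DFunLike.coe_fn_eq (f := f) (g := (0 : ι →₀ U))
  rw [h, h]
  exact decomposesTo_zero _

end Pi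

end Decomposition

/-! ### Graded free resolutions -/

section FreeDeg

variable {R : Type} [CommRing R] [Algebra ℚ R] {𝒜 : ℤ → Submodule ℚ R}

theorem single_mem_freeDeg {ι : Type} {deg : ι → ℤ} {b : ι} {q : ℤ} {r : R}
    (hr : r ∈ 𝒜 (q - deg b)) : Finsupp.single b r ∈ freeDeg 𝒜 deg q := by
  classical
  intro c
  rw [Finsupp.single_apply]
  split_ifs with h
  · rwa [← h]
  · exact zero_mem _

variable [SetLike.GradedMonoid 𝒜]

theorem single_one_mem_freeDeg {ι : Type} (deg : ι → ℤ) (b : ι) :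
    Finsupp.single b (1 : R) ∈ freeDeg 𝒜 deg (deg b) :=
  single_mem_freeDeg (by rw [sub_self]; exact SetLike.one_mem_graded 𝒜)

theorem smul_mem_freeDeg {ι : Type} {deg : ι → ℤ} {i q : ℤ} {r : R} {f : ι →₀ R}
    (hr : r ∈ 𝒜 i) (hf : f ∈ freeDeg 𝒜 deg q) : r • f ∈ freeDeg 𝒜 deg (i + q) := by
  intro b
  have := SetLike.mul_mem_graded hr (hf b)
  rwa [← add_sub_assoc] at this

theorem map_mem_freeDeg {ι κ : Type} {deg : ι → ℤ} {deg' : κ → ℤ}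
    {f : (ι →₀ R) →ₗ[R] (κ →₀ R)}
    (hf : ∀ b, f (Finsupp.single b 1) ∈ freeDeg 𝒜 deg' (deg b)) {q : ℤ} {y : ι →₀ R}
    (hy : y ∈ freeDeg 𝒜 deg q) : f y ∈ freeDeg 𝒜 deg' q := by
  have h : f y = ∑ b ∈ y.support, y b • f (Finsupp.single b 1) := by
    conv_lhs => rw [← Finsupp.sum_single y, Finsupp.sum, map_sum]
    refine Finset.sum_congr rfl fun b _ => ?_
    rw [← map_smul, Finsupp.smul_single, smul_eq_mul, mul_one]
  rw [h]
  refine sum_mem fun b _ => ?_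
  have := smul_mem_freeDeg (hy b) (hf b)
  rwa [sub_add_cancel] at this

omit [Algebra ℚ R] [SetLike.GradedMonoid 𝒜] in
/-- Maps out of a graded free module lift through maps that are surjective in the relevant
degrees. -/
theorem exists_graded_lift {ι X Y : Type} [AddCommGroup X] [Module R X] [AddCommGroup Y]
    [Module R Y] (P : ι → X → Prop) (δ : X →ₗ[R] Y) (g : (ι →₀ R) →ₗ[R] Y)
    (h : ∀ b, ∃ z, P b z ∧ δ z = g (Finsupp.single b 1)) :
    ∃ f : (ι →₀ R) →ₗ[R] X, (∀ b, P b (f (Finsupp.single b 1))) ∧ ∀ y, δ (f y) = g y := by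
  choose z hz hδ using h
  refine ⟨Finsupp.linearCombination R z, fun b => by simpa using hz b, fun y => ?_⟩
  have : δ ∘ₗ Finsupp.linearCombination R z = g := by
    ext b
    simp [hδ]
  exact LinearMap.congr_fun this y

end FreeDeg

/-- A resolution of a graded module by graded free modules; exactness is only required for
homogeneous elements. -/
structure GradedResolution {R M : Type} [CommRing R] [Algebra ℚ R] (𝒜 : ℤ → Submodule ℚ R)
    [AddCommGroup M] [Module R M] [Module ℚ M] (ℳ : ℤ → Submodule ℚ M) where
  gens : ℕ → Type
  deg : ∀ p, gens p → ℤ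
  d : ∀ p, (gens (p + 1) →₀ R) →ₗ[R] (gens p →₀ R)
  ε : (gens 0 →₀ R) →ₗ[R] M
  d_deg : ∀ p b, d p (Finsupp.single b 1) ∈ freeDeg 𝒜 (deg p) (deg (p + 1) b)
  ε_deg : ∀ b, ε (Finsupp.single b 1) ∈ ℳ (deg 0 b)
  cycles : ∀ p, Submodule R (gens p →₀ R)
  cycles_zero : cycles 0 = LinearMap.ker ε
  cycles_succ : ∀ p, cycles (p + 1) = LinearMap.ker (d p)
  d_mem : ∀ p y, d p y ∈ cycles p
  ε_surj : ∀ q, ∀ m ∈ ℳ q, ∃ y ∈ freeDeg 𝒜 (deg 0) q, ε y = m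
  exact : ∀ p q, ∀ y ∈ cycles p, y ∈ freeDeg 𝒜 (deg p) q →
    ∃ z ∈ freeDeg 𝒜 (deg (p + 1)) q, d p z = y

/-- The standard resolution. -/
def standardResolution {R M : Type} [CommRing R] [Algebra ℚ R] (𝒜 : ℤ → Submodule ℚ R)
    [SetLike.GradedMonoid 𝒜]
    [AddCommGroup M] [Module R M] [Module ℚ M] (ℳ : ℤ → Submodule ℚ M) :
    GradedResolution 𝒜 ℳ where
  gens p := (resolution 𝒜 ℳ p).gens
  deg p := (resolution 𝒜 ℳ p).deg
  d p := resBoundary 𝒜 ℳ p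
  ε := Finsupp.linearCombination R (fun b : (Σ i : ℤ, ↥(ℳ i)) => (b.2 : M))
  d_deg p b := by
    have : resBoundary 𝒜 ℳ p (Finsupp.single b 1) = b.2.1 := by
      erw [resBoundary, Finsupp.linearCombination_single, one_smul]
    rw [this]
    exact b.2.2.2
  ε_deg b := by
    erw [Finsupp.linearCombination_single, one_smul]
    exact b.2.2
  cycles p := (resolution 𝒜 ℳ p).sub
  cycles_zero := rfl
  cycles_succ _ := rfl
  d_mem p y := by
    erw [resBoundary, Finsupp.linearCombination_apply]
    exact sum_mem fun b _ => Submodule.smul_mem _ _ b.2.2.1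
  ε_surj q m hm := by
    refine ⟨Finsupp.single (⟨q, m, hm⟩ : Σ i : ℤ, ↥(ℳ i)) 1,
      single_one_mem_freeDeg (𝒜 := 𝒜) (resolution 𝒜 ℳ 0).deg (⟨q, m, hm⟩ : Σ i : ℤ, ↥(ℳ i)), ?_⟩
    erw [Finsupp.linearCombination_single, one_smul]
  exact p q y hy hq := by
    -- Every homogeneous cycle is itself the label of a generator, and the differential sends that
    -- generator to it.
    refine ⟨Finsupp.single (⟨q, y, hy, hq⟩ : (resolution 𝒜 ℳ (p + 1)).gens) 1,
      single_one_mem_freeDeg (𝒜 := 𝒜) (resolution 𝒜 ℳ (p + 1)).deg ⟨q, y, hy, hq⟩, ?_⟩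
    erw [resBoundary, Finsupp.linearCombination_single, one_smul]

/-! ### Comparison of graded free resolutions: chain maps and homotopies. -/

namespace GradedResolution

variable {R M : Type} [CommRing R] [Algebra ℚ R] {𝒜 : ℤ → Submodule ℚ R}
  [SetLike.GradedMonoid 𝒜] [AddCommGroup M] [Module R M] [Module ℚ M] {ℳ : ℤ → Submodule ℚ M}

/-- Degree-preserving chain maps over the identity of the resolved module. -/
structure ChainMap (F G : GradedResolution 𝒜 ℳ) where
  f : ∀ p, (F.gens p →₀ R) →ₗ[R] (G.gens p →₀ R)
  f_deg : ∀ p b, f p (Finsupp.single b 1) ∈ freeDeg 𝒜 (G.deg p) (F.deg p b)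
  ε_f : ∀ y, G.ε (f 0 y) = F.ε y
  d_f : ∀ p y, G.d p (f (p + 1) y) = f p (F.d p y)

omit [SetLike.GradedMonoid 𝒜] in
theorem d_d (F : GradedResolution 𝒜 ℳ) (p : ℕ) (y) : F.d p (F.d (p + 1) y) = 0 := by
  have := F.d_mem (p + 1) y
  rwa [F.cycles_succ] at this

omit [SetLike.GradedMonoid 𝒜] in
theorem ε_d (F : GradedResolution 𝒜 ℳ) (y) : F.ε (F.d 0 y) = 0 := by
  have := F.d_mem 0 y
  rwa [F.cycles_zero] at this

/-- The partial lifts from which chain maps are built. -/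
def PartialLift (F G : GradedResolution 𝒜 ℳ) (p : ℕ) : Type :=
  {f : (F.gens p →₀ R) →ₗ[R] (G.gens p →₀ R) //
    (∀ b, f (Finsupp.single b 1) ∈ freeDeg 𝒜 (G.deg p) (F.deg p b)) ∧
    ∀ y ∈ F.cycles p, f y ∈ G.cycles p}

/-- The composite of `f` with the differential of `F` sends basis elements to homogeneous cycles of
`G`, which are boundaries by exactness. The lift preserves cycles, so the construction can be
iterated. -/
theorem exists_next (F G : GradedResolution 𝒜 ℳ) (p : ℕ) (f : PartialLift F G p) :
    ∃ f' : PartialLift F G (p + 1), ∀ y, G.d p (f'.1 y) = f.1 (F.d p y) := by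
  obtain ⟨f', h1, h2⟩ := exists_graded_lift
    (fun b z => z ∈ freeDeg 𝒜 (G.deg (p + 1)) (F.deg (p + 1) b)) (G.d p) (f.1 ∘ₗ F.d p)
    (fun b => by
      obtain ⟨z, hz, h⟩ := G.exact p _ _ (f.2.2 _ (F.d_mem p (Finsupp.single b 1)))
        (map_mem_freeDeg f.2.1 (F.d_deg p b))
      exact ⟨z, hz, h⟩)
  refine ⟨⟨f', h1, fun y hy => ?_⟩, h2⟩
  rw [F.cycles_succ, LinearMap.mem_ker] at hy
  rw [G.cycles_succ, LinearMap.mem_ker, h2, LinearMap.comp_apply, hy, map_zero]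

theorem exists_chainMap (F G : GradedResolution 𝒜 ℳ) : Nonempty (ChainMap F G) := by
  obtain ⟨f₀, h1, h2⟩ := exists_graded_lift
    (fun b z => z ∈ freeDeg 𝒜 (G.deg 0) (F.deg 0 b)) G.ε F.ε
    (fun b => by
      obtain ⟨z, hz, h⟩ := G.ε_surj _ _ (F.ε_deg b)
      exact ⟨z, hz, h⟩)
  choose next hnext using exists_next F G
  let f : ∀ p, PartialLift F G p := fun p => Nat.rec ⟨f₀, h1, fun y hy => by
    rw [F.cycles_zero, LinearMap.mem_ker] at hy
    rw [G.cycles_zero, LinearMap.mem_ker, h2, hy]⟩ next p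
  exact ⟨⟨fun p => (f p).1, fun p => (f p).2.1, h2, fun p => hnext p (f p)⟩⟩

/-- The composition of chain maps. -/
def ChainMap.comp {F G H : GradedResolution 𝒜 ℳ} (g : ChainMap G H) (f : ChainMap F G) :
    ChainMap F H where
  f p := g.f p ∘ₗ f.f p
  f_deg p b := map_mem_freeDeg (g.f_deg p) (f.f_deg p b)
  ε_f y := by rw [LinearMap.comp_apply, g.ε_f, f.ε_f]
  d_f p y := by simp only [LinearMap.comp_apply, g.d_f, f.d_f]

section Homotopy

variable {F : GradedResolution 𝒜 ℳ} (f : ChainMap F F)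

/-- The difference of `f` and the identity is killed by `ε`, so on basis elements it consists of
homogeneous cycles. -/
theorem ChainMap.exists_homotopy_zero :
    ∃ s : (F.gens 0 →₀ R) →ₗ[R] (F.gens 1 →₀ R),
      (∀ b, s (Finsupp.single b 1) ∈ freeDeg 𝒜 (F.deg 1) (F.deg 0 b)) ∧
      ∀ y, F.d 0 (s y) = f.f 0 y - y := by
  refine exists_graded_lift (fun b z => z ∈ freeDeg 𝒜 (F.deg 1) (F.deg 0 b)) (F.d 0)
    (f.f 0 - LinearMap.id) (fun b => ?_)
  obtain ⟨z, hz, h⟩ := F.exact 0 (F.deg 0 b) ((f.f 0 - (LinearMap.id : _ →ₗ[R] _) : _ →ₗ[R] _) (Finsupp.single b 1))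
    (by rw [F.cycles_zero, LinearMap.mem_ker]; simp [f.ε_f])
    (sub_mem (f.f_deg 0 b) (single_one_mem_freeDeg _ b))
  exact ⟨z, hz, h⟩

/-- With `d s = f - 1` on cycles, hence on boundaries, the map `f - 1 - s d` takes values in cycles
and lifts through the next differential. -/
theorem ChainMap.exists_homotopy_succ (p : ℕ) (s : (F.gens p →₀ R) →ₗ[R] (F.gens (p + 1) →₀ R))
    (hs : ∀ b, s (Finsupp.single b 1) ∈ freeDeg 𝒜 (F.deg (p + 1)) (F.deg p b))
    (hd : ∀ y ∈ F.cycles p, F.d p (s y) = f.f p y - y) :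
    ∃ s' : (F.gens (p + 1) →₀ R) →ₗ[R] (F.gens (p + 2) →₀ R),
      (∀ b, s' (Finsupp.single b 1) ∈ freeDeg 𝒜 (F.deg (p + 2)) (F.deg (p + 1) b)) ∧
      ∀ y, F.d (p + 1) (s' y) = f.f (p + 1) y - y - s (F.d p y) := by
  refine exists_graded_lift (fun b z => z ∈ freeDeg 𝒜 (F.deg (p + 2)) (F.deg (p + 1) b))
    (F.d (p + 1)) (f.f (p + 1) - LinearMap.id - s ∘ₗ F.d p) (fun b => ?_)
  obtain ⟨z, hz, h⟩ := F.exact (p + 1) (F.deg (p + 1) b)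
    ((f.f (p + 1) - (LinearMap.id : _ →ₗ[R] _) - s ∘ₗ F.d p : _ →ₗ[R] _) (Finsupp.single b 1))
    (by
      rw [F.cycles_succ, LinearMap.mem_ker]
      simp only [LinearMap.sub_apply, LinearMap.comp_apply, LinearMap.id_apply, map_sub, f.d_f]
      rw [hd _ (F.d_mem p _)]
      abel)
    (sub_mem (sub_mem (f.f_deg (p + 1) b) (single_one_mem_freeDeg _ b))
      (map_mem_freeDeg hs (F.d_deg p b)))
  exact ⟨z, hz, h⟩

/-- The homotopy identity is only asked for on cycles: there the term `s d` disappears, so the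
induction carries a single map `s` instead of two. -/
theorem ChainMap.exists_homotopy (p : ℕ) :
    ∃ s : (F.gens p →₀ R) →ₗ[R] (F.gens (p + 1) →₀ R),
      (∀ b, s (Finsupp.single b 1) ∈ freeDeg 𝒜 (F.deg (p + 1)) (F.deg p b)) ∧
      ∀ y ∈ F.cycles p, F.d p (s y) = f.f p y - y := by
  induction p with
  | zero =>
    obtain ⟨s, h1, h2⟩ := f.exists_homotopy_zero
    exact ⟨s, h1, fun y _ => h2 y⟩
  | succ p ih =>
    obtain ⟨s, h1, h2⟩ := ih
    obtain ⟨s', h1', h2'⟩ := f.exists_homotopy_succ p s h1 h2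
    refine ⟨s', h1', fun y hy => ?_⟩
    rw [F.cycles_succ, LinearMap.mem_ker] at hy
    rw [h2', hy, map_zero, sub_zero]

end Homotopy

end GradedResolution

/-! ### Dimensions of homogeneous parts of subquotients -/

section Rank

variable {R M R' M' : Type} [CommRing R] [Algebra ℚ R] [AddCommGroup M] [Module R M] [Module ℚ M]
  [IsScalarTower ℚ R M] [CommRing R'] [Algebra ℚ R'] [AddCommGroup M'] [Module R' M'] [Module ℚ M']
  [IsScalarTower ℚ R' M']

/-- The map from `Z ∩ N` onto the part of `Z / W` represented by `N`. -/
def SubQuot.toPart (Z W : Submodule R M) (N : Submodule ℚ M) :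
    ↥(N.comap (Z.subtype.restrictScalars ℚ)) →ₗ[ℚ] SubQuot.part ℚ Z W N :=
  ((W.submoduleOf Z).mkQ.restrictScalars ℚ).submoduleMap _

theorem SubQuot.toPart_surjective (Z W : Submodule R M) (N : Submodule ℚ M) :
    Function.Surjective (SubQuot.toPart Z W N) :=
  LinearMap.submoduleMap_surjective _ _

theorem SubQuot.toPart_eq_zero {Z W : Submodule R M} {N : Submodule ℚ M}
    (z : ↥(N.comap (Z.subtype.restrictScalars ℚ))) :
    SubQuot.toPart Z W N z = 0 ↔ (z.1 : M) ∈ W := by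
  rw [← Subtype.coe_inj]
  change (W.submoduleOf Z).mkQ z.1 = 0 ↔ _
  rw [Submodule.mkQ_apply, Submodule.Quotient.mk_eq_zero]
  rfl

/-- The conditions say that `u` induces a well-defined injection between the two parts:
representatives of zero, and only those, go to representatives of zero. -/
theorem rank_part_le (Z W : Submodule R M) (N : Submodule ℚ M) (Z' W' : Submodule R' M')
    (N' : Submodule ℚ M') (u : M →ₗ[ℚ] M') (hu : ∀ z ∈ Z, z ∈ N → u z ∈ Z' ∧ u z ∈ N')
    (hW : ∀ z ∈ Z, z ∈ N → u z ∈ W' → z ∈ W)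
    (hW' : ∀ z ∈ Z, z ∈ N → z ∈ W → u z ∈ W') :
    Module.rank ℚ (SubQuot.part ℚ Z W N) ≤ Module.rank ℚ (SubQuot.part ℚ Z' W' N') := by
  let U : ↥(N.comap (Z.subtype.restrictScalars ℚ)) →ₗ[ℚ]
      ↥(N'.comap (Z'.subtype.restrictScalars ℚ)) :=
    { toFun := fun z => ⟨⟨u z.1, (hu _ z.1.2 z.2).1⟩, (hu _ z.1.2 z.2).2⟩
      map_add' := fun x y => Subtype.ext (Subtype.ext (map_add u _ _))
      map_smul' := fun r x => Subtype.ext (Subtype.ext (map_smul u r _)) }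
  have hk : LinearMap.ker (SubQuot.toPart Z W N) =
      LinearMap.ker (SubQuot.toPart Z' W' N' ∘ₗ U) := by
    ext z
    rw [LinearMap.mem_ker, LinearMap.mem_ker, LinearMap.comp_apply, SubQuot.toPart_eq_zero,
      SubQuot.toPart_eq_zero]
    exact ⟨hW' _ z.1.2 z.2, hW _ z.1.2 z.2⟩
  rw [← ((SubQuot.toPart Z W N).quotKerEquivOfSurjective
    (SubQuot.toPart_surjective Z W N)).rank_eq, hk,
    ((SubQuot.toPart Z' W' N' ∘ₗ U).quotKerEquivRange).rank_eq]
  exact Submodule.rank_le _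

theorem rank_part_eq_of_equiv (Z W : Submodule R M) (N : Submodule ℚ M) (Z' W' : Submodule R' M')
    (N' : Submodule ℚ M') (u : M ≃ₗ[ℚ] M') (hZ : ∀ z, u z ∈ Z' ↔ z ∈ Z)
    (hW : ∀ z, u z ∈ W' ↔ z ∈ W) (hN : ∀ z, u z ∈ N' ↔ z ∈ N) :
    Module.rank ℚ (SubQuot.part ℚ Z W N) = Module.rank ℚ (SubQuot.part ℚ Z' W' N') := by
  refine le_antisymm ?_ ?_
  · refine rank_part_le _ _ _ _ _ _ u.toLinearMap (fun z h1 h2 => ⟨(hZ z).2 h1, (hN z).2 h2⟩)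
      (fun z _ _ => (hW z).1) (fun z _ _ => (hW z).2)
  · refine rank_part_le _ _ _ _ _ _ u.symm.toLinearMap
      (fun z h1 h2 => ⟨(hZ _).1 (by simpa using h1), (hN _).1 (by simpa using h2)⟩)
      (fun z _ _ h => ?_) (fun z _ _ h => (hW _).1 (by simpa using h))
    simpa using (hW _).2 h

end Rank

/-! ### Reduction of a resolution along an augmentation -/

section Reduction

variable {R : Type} [CommRing R] [Algebra ℚ R] (c : R →ₐ[ℚ] ℚ)

/-- The reduction of vectors. -/
def redVec (ι : Type) : (ι →₀ R) →ₗ[ℚ] (ι →₀ ℚ) := Finsupp.mapRange.linearMap c.toLinearMap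

theorem redVec_apply {ι : Type} (y : ι →₀ R) (b : ι) : redVec c ι y b = c (y b) := rfl

theorem redVec_smul {ι : Type} (r : R) (y : ι →₀ R) :
    redVec c ι (r • y) = c r • redVec c ι y := by
  ext b
  simp [redVec_apply]

theorem redVec_single {ι : Type} (b : ι) (r : R) :
    redVec c ι (Finsupp.single b r) = Finsupp.single b (c r) := by
  simp [redVec]

theorem redVec_surjective (ι : Type) : Function.Surjective (redVec c ι) :=
  Finsupp.mapRange_surjective _ (map_zero c) fun r => ⟨algebraMap ℚ R r, by simp⟩

/-- The reduction of linear maps between free modules. -/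
def redMap {ι κ : Type} (f : (ι →₀ R) →ₗ[R] (κ →₀ R)) : (ι →₀ ℚ) →ₗ[ℚ] (κ →₀ ℚ) :=
  Finsupp.linearCombination ℚ (fun b => redVec c κ (f (Finsupp.single b 1)))

theorem redMap_redVec {ι κ : Type} (f : (ι →₀ R) →ₗ[R] (κ →₀ R)) (y : ι →₀ R) :
    redMap c f (redVec c ι y) = redVec c κ (f y) := by
  induction y using Finsupp.induction_linear with
  | zero => simp
  | add a b ha hb => simp only [map_add, ha, hb]
  | single b r =>
    have : Finsupp.single b r = r • Finsupp.single b 1 := by simp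
    rw [redVec_single, redMap, Finsupp.linearCombination_single, this, map_smul, redVec_smul]

variable {M : Type} {𝒜 : ℤ → Submodule ℚ R} [AddCommGroup M] [Module R M] [Module ℚ M]
  {ℳ : ℤ → Submodule ℚ M}

/-! ### Homology of the reduced complex and its independence of the resolution. -/

namespace GradedResolution

/-- The cycles of the reduced complex. -/
def redCycles (F : GradedResolution 𝒜 ℳ) : ∀ p, Submodule ℚ (F.gens p →₀ ℚ)
  | 0 => ⊤
  | p + 1 => LinearMap.ker (redMap c (F.d p))

/-- The dimension of the homology of the reduced complex in degree `q`. -/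
def redRank (F : GradedResolution 𝒜 ℳ) (p : ℕ) (q : ℤ) : Cardinal.{0} :=
  Module.rank ℚ (SubQuot.part ℚ (F.redCycles c p) (LinearMap.range (redMap c (F.d p)))
    ((freeDeg 𝒜 (F.deg p) q).map (redVec c (F.gens p))))

theorem ChainMap.redCycles_mem {F G : GradedResolution 𝒜 ℳ} (f : ChainMap F G) (p : ℕ)
    {z : F.gens p →₀ ℚ} (hz : z ∈ F.redCycles c p) : redMap c (f.f p) z ∈ G.redCycles c p := by
  cases p with
  | zero => trivial
  | succ p =>
    obtain ⟨y, rfl⟩ := redVec_surjective c _ z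
    simp only [redCycles, LinearMap.mem_ker, redMap_redVec, f.d_f] at hz ⊢
    rw [← redMap_redVec, hz, map_zero]

theorem ChainMap.range_mem {F G : GradedResolution 𝒜 ℳ} (f : ChainMap F G) (p : ℕ)
    {z : F.gens p →₀ ℚ} (hz : z ∈ LinearMap.range (redMap c (F.d p))) :
    redMap c (f.f p) z ∈ LinearMap.range (redMap c (G.d p)) := by
  obtain ⟨y, rfl⟩ := hz
  obtain ⟨y, rfl⟩ := redVec_surjective c _ y
  refine ⟨redVec c _ (f.f (p + 1) y), ?_⟩
  simp only [redMap_redVec, f.d_f]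

variable [SetLike.GradedMonoid 𝒜]

/-- The identity `f - 1 = d s' + s d` survives reduction, and `s d` vanishes on a reduced cycle. Its
lift `y` over `R` need not be a cycle, so here the identity is needed on all vectors. -/
theorem ChainMap.sub_mem_range {F : GradedResolution 𝒜 ℳ} (f : ChainMap F F) (p : ℕ)
    {z : F.gens p →₀ ℚ} (hz : z ∈ F.redCycles c p) :
    redMap c (f.f p) z - z ∈ LinearMap.range (redMap c (F.d p)) := by
  obtain ⟨y, rfl⟩ := redVec_surjective c _ z
  cases p with
  | zero =>
    obtain ⟨s, -, hs⟩ := f.exists_homotopy_zero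
    exact ⟨redVec c _ (s y), by rw [redMap_redVec, redMap_redVec, hs, map_sub]⟩
  | succ p =>
    obtain ⟨s, h1, h2⟩ := f.exists_homotopy p
    obtain ⟨s', -, h2'⟩ := f.exists_homotopy_succ p s h1 h2
    refine ⟨redVec c _ (s' y), ?_⟩
    simp only [redCycles, LinearMap.mem_ker, redMap_redVec] at hz
    rw [redMap_redVec, redMap_redVec, h2', map_sub, map_sub, ← redMap_redVec c s, hz, map_zero,
      sub_zero]

/-- The composite of comparison maps `F → G → F` is homotopic to the identity, so `F → G` is
injective on reduced homology. -/
theorem redRank_le (F G : GradedResolution 𝒜 ℳ) (p : ℕ) (q : ℤ) :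
    F.redRank c p q ≤ G.redRank c p q := by
  obtain ⟨f⟩ := exists_chainMap F G
  obtain ⟨g⟩ := exists_chainMap G F
  refine rank_part_le _ _ _ _ _ _ (redMap c (f.f p)) (fun z hz hN => ⟨f.redCycles_mem c p hz, ?_⟩)
    (fun z hz _ h => ?_) (fun z _ _ => f.range_mem c p)
  · obtain ⟨y, hy, rfl⟩ := hN
    exact ⟨f.f p y, map_mem_freeDeg (f.f_deg p) hy, (redMap_redVec c _ y).symm⟩
  · have h1 := (g.comp f).sub_mem_range c p hz
    have h2 := g.range_mem c p h
    have h3 : redMap c (g.f p) (redMap c (f.f p) z) = redMap c ((g.comp f).f p) z := by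
      obtain ⟨y, rfl⟩ := redVec_surjective c _ z
      simp only [redMap_redVec, ChainMap.comp, LinearMap.comp_apply]
    rw [h3] at h2
    simpa using sub_mem h2 h1

/-- The homology of the reduced complex does not depend on the resolution. -/
theorem redRank_eq (F G : GradedResolution 𝒜 ℳ) (p : ℕ) (q : ℤ) :
    F.redRank c p q = G.redRank c p q :=
  le_antisymm (redRank_le c F G p q) (redRank_le c G F p q)

end GradedResolution

/-! ### Tensoring with `R / I` as reduction along the augmentation. -/

variable (I : Ideal R) (hI : ∀ r, r ∈ I ↔ c r = 0)

/-- `R / I ≃ ℚ` for the kernel `I` of an augmentation. -/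
def quotEquivRat : (R ⧸ I) ≃ₗ[ℚ] ℚ :=
  LinearEquiv.ofBijective (Ideal.Quotient.liftₐ I c fun r hr => (hI r).1 hr).toLinearMap (by
    refine ⟨(injective_iff_map_eq_zero _).2 fun r hr => ?_, fun r => ⟨algebraMap ℚ _ r, by simp⟩⟩
    obtain ⟨r, rfl⟩ := Ideal.Quotient.mk_surjective r
    exact Ideal.Quotient.eq_zero_iff_mem.2 ((hI r).2 hr))

theorem quotEquivRat_mk (r : R) : quotEquivRat c I hI (Ideal.Quotient.mk I r) = c r := rfl

open scoped Classical in
/-- `R / I ⊗ F ≃ F / I F`. -/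
def tensorEquiv (ι : Type) : (R ⧸ I) ⊗[R] (ι →₀ R) ≃ₗ[ℚ] (ι →₀ ℚ) :=
  ((TensorProduct.finsuppScalarRight R R (R ⧸ I) ι).restrictScalars ℚ).trans
    (Finsupp.mapRange.linearEquiv (quotEquivRat c I hI))

theorem tensorEquiv_tmul {ι : Type} (r : R) (y : ι →₀ R) :
    tensorEquiv c I hI ι (Ideal.Quotient.mk I r ⊗ₜ y) = redVec c ι (r • y) := by
  ext b
  have h : y b • Ideal.Quotient.mk I r = Ideal.Quotient.mk I (r * y b) := by
    rw [mul_comm, map_mul]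
    rfl
  classical
  change quotEquivRat c I hI
    (TensorProduct.finsuppScalarRight R R (R ⧸ I) ι (Ideal.Quotient.mk I r ⊗ₜ y) b) = c (r * y b)
  rw [TensorProduct.finsuppScalarRight_apply_tmul_apply, h, quotEquivRat_mk]

omit [Algebra ℚ R] in
-- Every class in `R / I` lifts to `R`, so scalars can be moved to the right factor. Identities on
-- the tensor product need only be checked on `1 ⊗ y`.
theorem exists_one_tmul {ι : Type} (z : (R ⧸ I) ⊗[R] (ι →₀ R)) :
    ∃ y : ι →₀ R, z = (1 : R ⧸ I) ⊗ₜ y := by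
  induction z with
  | zero => exact ⟨0, by simp⟩
  | tmul r y =>
    obtain ⟨r, rfl⟩ := Ideal.Quotient.mk_surjective r
    refine ⟨r • y, ?_⟩
    rw [← TensorProduct.smul_tmul]
    congr 1
    exact (mul_one _).symm
  | add a b ha hb =>
    obtain ⟨a, rfl⟩ := ha
    obtain ⟨b, rfl⟩ := hb
    exact ⟨a + b, by rw [TensorProduct.tmul_add]⟩

theorem tensorEquiv_one_tmul {ι : Type} (y : ι →₀ R) :
    tensorEquiv c I hI ι (1 ⊗ₜ y) = redVec c ι y := by
  rw [← map_one (Ideal.Quotient.mk I), tensorEquiv_tmul, one_smul]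

theorem tensorEquiv_lTensor {ι κ : Type} (f : (ι →₀ R) →ₗ[R] (κ →₀ R))
    (z : (R ⧸ I) ⊗[R] (ι →₀ R)) :
    tensorEquiv c I hI κ (LinearMap.lTensor (R ⧸ I) f z) =
      redMap c f (tensorEquiv c I hI ι z) := by
  obtain ⟨y, rfl⟩ := exists_one_tmul I z
  rw [LinearMap.lTensor_tmul, tensorEquiv_one_tmul, tensorEquiv_one_tmul, redMap_redVec]

variable [SetLike.GradedMonoid 𝒜]

theorem tensorEquiv_mem {ι : Type} (deg : ι → ℤ) (q : ℤ) (z : (R ⧸ I) ⊗[R] (ι →₀ R)) :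
    tensorEquiv c I hI ι z ∈ (freeDeg 𝒜 deg q).map (redVec c ι) ↔
      z ∈ tensorDeg (quotDeg 𝒜 I) (freeDeg 𝒜 deg) q := by
  constructor
  · rintro ⟨y, hy, h⟩
    rw [← tensorEquiv_one_tmul c I hI] at h
    rw [← (tensorEquiv c I hI ι).injective h]
    exact Submodule.subset_span ⟨0, q, zero_add q, 1, ⟨1, SetLike.one_mem_graded 𝒜, rfl⟩, y, hy,
      rfl⟩
  · intro hz
    refine (Submodule.span_le (p := ((freeDeg 𝒜 deg q).map (redVec c ι)).comap
      (tensorEquiv c I hI ι).toLinearMap)).2 ?_ hz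
    rintro _ ⟨a, b, rfl, _, ⟨r, hr, rfl⟩, y, hy, rfl⟩
    exact ⟨r • y, smul_mem_freeDeg hr hy, (tensorEquiv_tmul c I hI r y).symm⟩

include hI in
/-- Betti numbers can be computed from any graded free resolution. -/
theorem bettiNumber_eq_redRank (F : GradedResolution 𝒜 ℳ) (p : ℕ) (q : ℤ) :
    bettiNumber 𝒜 I ℳ p q = F.redRank c p q := by
  rw [GradedResolution.redRank_eq c F (standardResolution 𝒜 ℳ)]
  refine rank_part_eq_of_equiv _ _ _ _ _ _ (tensorEquiv c I hI (resolution 𝒜 ℳ p).gens)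
    (fun z => ?_) (fun z => ?_) (fun z => tensorEquiv_mem c I hI _ q z)
  · cases p with
    | zero => exact Iff.rfl
    | succ p =>
      change redMap c (resBoundary 𝒜 ℳ p) _ = 0 ↔ LinearMap.lTensor (R ⧸ I) (resBoundary 𝒜 ℳ p) z = 0
      erw [← tensorEquiv_lTensor c I hI]
      exact LinearEquiv.map_eq_zero_iff _
  · constructor
    · rintro ⟨y, hy⟩
      obtain ⟨y, rfl⟩ := (tensorEquiv c I hI _).surjective y
      refine ⟨y, (tensorEquiv c I hI (resolution 𝒜 ℳ p).gens).injective ?_⟩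
      exact (tensorEquiv_lTensor c I hI (resBoundary 𝒜 ℳ p) y).trans hy
    · rintro ⟨y, rfl⟩
      exact ⟨_, (tensorEquiv_lTensor c I hI (resBoundary 𝒜 ℳ p) y).symm⟩

end Reduction

/-! ### Free extensions of graded rings and modules -/

/-- The maps `v ↦ x k • φ v`. -/
def twist {κ S' V W : Type} [CommRing S'] [AddCommGroup V] [AddCommGroup W] [Module S' W]
    (φ : V →+ W) (x : κ → S') (k : κ) : V →+ W :=
  (DistribSMul.toAddMonoidHom W (x k)).comp φ

theorem twist_apply {κ S' V W : Type} [CommRing S'] [AddCommGroup V] [AddCommGroup W] [Module S' W]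
    (φ : V →+ W) (x : κ → S') (k : κ) (v : V) : twist φ x k v = x k • φ v := rfl

section Extend

variable {κ S S' ι N N' : Type} [CommRing S] [CommRing S'] (j : S →+* S')
  [AddCommGroup N] [Module S N] [AddCommGroup N'] [Module S' N']

/-- The extension of vectors along a ring homomorphism. -/
def extVec (ι : Type) : (ι →₀ S) →+ (ι →₀ S') := Finsupp.mapRange.addMonoidHom j.toAddMonoidHom

theorem extVec_apply (y : ι →₀ S) (b : ι) : extVec j ι y b = j (y b) := rfl

theorem extVec_single (b : ι) (r : S) :
    extVec j ι (Finsupp.single b r) = Finsupp.single b (j r) := by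
  simp [extVec]

theorem extVec_smul (r : S) (y : ι →₀ S) : extVec j ι (r • y) = j r • extVec j ι y := by
  ext b
  simp [extVec_apply]

/-- The extension of a linear map out of a free module. -/
def extMap (g : (ι →₀ S) →ₗ[S] N) (ψ : N →+ N') : (ι →₀ S') →ₗ[S'] N' :=
  Finsupp.linearCombination S' (fun b => ψ (g (Finsupp.single b 1)))

theorem extMap_single (g : (ι →₀ S) →ₗ[S] N) (ψ : N →+ N') (b : ι) :
    extMap (S' := S') g ψ (Finsupp.single b 1) = ψ (g (Finsupp.single b 1)) := by
  simp [extMap]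

theorem extMap_extVec (g : (ι →₀ S) →ₗ[S] N) (ψ : N →+ N') (hψ : ∀ r m, ψ (r • m) = j r • ψ m)
    (y : ι →₀ S) : extMap g ψ (extVec j ι y) = ψ (g y) := by
  induction y using Finsupp.induction_linear with
  | zero => simp
  | add a b ha hb => simp only [map_add, ha, hb]
  | single b r =>
    have : Finsupp.single b r = r • Finsupp.single b 1 := by simp
    rw [extVec_single, extMap, Finsupp.linearCombination_single, this, map_smul, hψ]

theorem finsuppMaps_twist (x : κ → S') (k : κ) (y : ι →₀ S) :
    finsuppMaps ι (twist j.toAddMonoidHom x) k y = x k • extVec j ι y := by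
  ext b
  rfl

theorem extMap_finsuppMaps (g : (ι →₀ S) →ₗ[S] N) (ψ : N →+ N')
    (hψ : ∀ r m, ψ (r • m) = j r • ψ m) (x : κ → S') (k : κ) (y : ι →₀ S) :
    extMap g ψ (finsuppMaps ι (twist j.toAddMonoidHom x) k y) = twist ψ x k (g y) := by
  rw [finsuppMaps_twist, map_smul, extMap_extVec j g ψ hψ, twist_apply]

theorem extMap_extVec_finsuppMaps {ι' : Type} (g : (ι →₀ S) →ₗ[S] (ι' →₀ S)) (x : κ → S') (k : κ)
    (y : ι →₀ S) :
    extMap g (extVec j ι') (finsuppMaps ι (twist j.toAddMonoidHom x) k y) =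
      finsuppMaps ι' (twist j.toAddMonoidHom x) k (g y) := by
  rw [extMap_finsuppMaps j g _ (extVec_smul j), finsuppMaps_twist, twist_apply]

end Extend

/-- `S'` is a graded free extension of `S` with homogeneous basis `x k` of degrees `wt k`,
containing `1`. -/
structure FreeExtension {κ S S' : Type} [CommRing S] [CommRing S'] [Algebra ℚ S] [Algebra ℚ S']
    (𝒮 : ℤ → Submodule ℚ S) (𝒮' : ℤ → Submodule ℚ S') (j : S →ₐ[ℚ] S') (x : κ → S')
    (wt : κ → ℤ) : Prop where
  dec : Decomposes (twist j.toRingHom.toAddMonoidHom x)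
  decDeg : ∀ q, DecomposesTo (twist j.toRingHom.toAddMonoidHom x) (fun k => ↑(𝒮 (q - wt k)))
    (𝒮' q : Set S')
  one : ∃ k, x k = 1 ∧ wt k = 0

section BaseChange

variable {κ S S' M M' : Type} [CommRing S] [CommRing S'] [Algebra ℚ S] [Algebra ℚ S']
  {𝒮 : ℤ → Submodule ℚ S} {𝒮' : ℤ → Submodule ℚ S'} {j : S →ₐ[ℚ] S'} {x : κ → S'} {wt : κ → ℤ}
  [AddCommGroup M] [Module S M] [Module ℚ M] {ℳ : ℤ → Submodule ℚ M}
  [AddCommGroup M'] [Module S' M'] [Module ℚ M'] {ℳ' : ℤ → Submodule ℚ M'}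

theorem FreeExtension.map_mem (h : FreeExtension 𝒮 𝒮' j x wt) {q : ℤ} {r : S} (hr : r ∈ 𝒮 q) :
    j r ∈ 𝒮' q := by
  obtain ⟨k, hk, hk'⟩ := h.one
  have := (h.decDeg q).mem k r (by rw [hk', sub_zero]; exact hr)
  rw [twist_apply, hk, one_smul] at this
  exact this

/-- The overall shift `s` of the module is absorbed into the degrees of the generators, and the
degree of `x k` is subtracted from that of the `k`-th coordinate. -/
theorem FreeExtension.freeDeg (h : FreeExtension 𝒮 𝒮' j x wt) {ι : Type} (deg : ι → ℤ) (s q : ℤ) :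
    DecomposesTo (finsuppMaps ι (twist j.toRingHom.toAddMonoidHom x))
      (fun k => (freeDeg 𝒮 deg (q - s - wt k) : Set (ι →₀ S)))
      (freeDeg 𝒮' (fun b => deg b + s) q : Set (ι →₀ S')) := by
  have := DecomposesTo.finsupp (fun b => h.decDeg (q - (deg b + s))) (fun _ _ => zero_mem _)
  convert this using 2 with k
  · ext f
    refine forall_congr' fun b => ?_
    rw [show q - s - wt k - deg b = q - (deg b + s) - wt k by ring]
    rfl
  · rfl

theorem extVec_semilinear (j : S →ₐ[ℚ] S') (ι : Type) (r : S) (y : ι →₀ S) :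
    extVec j.toRingHom ι (r • y) = j.toRingHom r • extVec j.toRingHom ι y :=
  extVec_smul _ _ _

/-- The extension of a graded free resolution along a graded free extension of rings. -/
def GradedResolution.baseChange (h : FreeExtension 𝒮 𝒮' j x wt) {φ : M →+ M'} {s : ℤ}
    (hφ : Decomposes (twist φ x)) (hφs : ∀ r m, φ (r • m) = j.toRingHom r • φ m)
    (hφd : ∀ q, DecomposesTo (twist φ x) (fun k => (ℳ (q - s - wt k) : Set M)) (ℳ' q : Set M'))
    (F : GradedResolution 𝒮 ℳ) : GradedResolution 𝒮' ℳ' where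
  gens := F.gens
  deg p b := F.deg p b + s
  d p := extMap (F.d p) (extVec j.toRingHom (F.gens p))
  ε := extMap F.ε φ
  d_deg p b c := by
    rw [extMap_single]
    have := h.map_mem (F.d_deg p b c)
    rwa [← add_sub_add_right_eq_sub _ _ s] at this
  ε_deg b := by
    rw [extMap_single]
    obtain ⟨k, hk, hk'⟩ := h.one
    have := (hφd (F.deg 0 b + s)).mem k (F.ε (Finsupp.single b 1)) (by
      rw [hk', sub_zero, add_sub_cancel_right]
      exact F.ε_deg b)
    rwa [twist_apply, hk, one_smul] at this
  cycles p := match p with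
    | 0 => LinearMap.ker (extMap F.ε φ)
    | p + 1 => LinearMap.ker (extMap (F.d p) (extVec j.toRingHom (F.gens p)))
  cycles_zero := rfl
  cycles_succ _ := rfl
  d_mem p y := by
    cases p with
    | zero =>
      have : extMap F.ε φ ∘ₗ extMap (F.d 0) (extVec j.toRingHom (F.gens 0)) =
          (0 : _ →ₗ[S'] M') := by
        ext b
        simp only [LinearMap.comp_apply, Finsupp.lsingle_apply, extMap_single,
          extMap_extVec _ F.ε φ hφs, F.ε_d, map_zero, LinearMap.zero_apply]
      exact LinearMap.congr_fun this y
    | succ p =>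
      have : extMap (F.d p) (extVec j.toRingHom (F.gens p)) ∘ₗ
          extMap (F.d (p + 1)) (extVec j.toRingHom (F.gens (p + 1))) =
          (0 : _ →ₗ[S'] _) := by
        apply Finsupp.lhom_ext'
        intro b
        apply LinearMap.ext_ring
        simp only [LinearMap.comp_apply, Finsupp.lsingle_apply, extMap_single,
          extMap_extVec _ (F.d p) _ (extVec_semilinear j _), F.d_d, map_zero, LinearMap.zero_apply]
      exact LinearMap.congr_fun this y
  ε_surj q m hm := by
    -- Surjectivity and exactness are both proved in coordinates: decompose the target element, lift
    -- each coordinate in `F` in its own degree, and reassemble.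
    obtain ⟨v, hv, rfl⟩ := (hφd q).exists_eq m hm
    obtain ⟨z, hz, rfl⟩ := exists_finsupp_lift F.ε.toAddMonoidHom
      (fun k => (HOMFLYPT.freeDeg 𝒮 (F.deg 0) (q - s - wt k) : Set _)) (fun k => zero_mem _) v
      (fun k => F.ε_surj _ _ (hv k))
    have hz' := map_assemble
      (t := finsuppMaps (F.gens 0) (twist j.toRingHom.toAddMonoidHom x)) (t₁ := twist φ x)
      (f := F.ε.toAddMonoidHom) (g := (extMap F.ε φ).toAddMonoidHom)
      (fun k y => extMap_finsuppMaps _ F.ε φ hφs x k y) z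
    exact ⟨_, assemble_mem (h.freeDeg (F.deg 0) s q).mem z hz, hz'⟩
  exact p q y hy hq := by
    obtain ⟨v, hv, rfl⟩ := (h.freeDeg (F.deg p) s q).exists_eq y hq
    have hdec := h.dec.finsupp (F.gens p)
    -- The extended maps act coordinatewise, so the coordinates of a cycle are cycles of `F`.
    have hcyc : ∀ k, v k ∈ F.cycles p := by
      cases p with
      | zero =>
        rw [F.cycles_zero]
        exact hdec.mem_of_assemble_mem (hdec.ker hφ (d := F.ε.toAddMonoidHom)
          (d' := (extMap F.ε φ).toAddMonoidHom)
          (fun k y => extMap_finsuppMaps _ F.ε φ hφs x k y)) hy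
      | succ p =>
        rw [F.cycles_succ]
        exact hdec.mem_of_assemble_mem (hdec.ker (h.dec.finsupp (F.gens p))
          (d := (F.d p).toAddMonoidHom)
          (d' := (extMap (F.d p) (extVec j.toRingHom (F.gens p))).toAddMonoidHom)
          (fun k y => extMap_extVec_finsuppMaps _ (F.d p) x k y)) hy
    obtain ⟨z, hz, rfl⟩ := exists_finsupp_lift (F.d p).toAddMonoidHom
      (fun k => (HOMFLYPT.freeDeg 𝒮 (F.deg (p + 1)) (q - s - wt k) : Set _)) (fun k => zero_mem _) v
      (fun k => F.exact p _ _ (hcyc k) (hv k))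
    have hz' := map_assemble
      (t := finsuppMaps (F.gens (p + 1)) (twist j.toRingHom.toAddMonoidHom x))
      (t₁ := finsuppMaps (F.gens p) (twist j.toRingHom.toAddMonoidHom x))
      (f := (F.d p).toAddMonoidHom)
      (g := (extMap (F.d p) (extVec j.toRingHom (F.gens p))).toAddMonoidHom)
      (fun k y => extMap_extVec_finsuppMaps _ (F.d p) x k y) z
    exact ⟨_, assemble_mem (h.freeDeg (F.deg (p + 1)) s q).mem z hz, hz'⟩

variable [SetLike.GradedMonoid 𝒮] [SetLike.GradedMonoid 𝒮']

theorem algebraMap_mem_deg_zero (r : ℚ) : algebraMap ℚ S r ∈ 𝒮 0 := by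
  rw [Algebra.algebraMap_eq_smul_one]
  exact Submodule.smul_mem _ _ (SetLike.one_mem_graded 𝒮)

/-- Betti numbers are invariant under graded free extensions. -/
theorem bettiNumber_eq_of_freeExtension (h : FreeExtension 𝒮 𝒮' j x wt) {φ : M →+ M'} {s : ℤ}
    (hφ : Decomposes (twist φ x)) (hφs : ∀ r m, φ (r • m) = j.toRingHom r • φ m)
    (hφd : ∀ q, DecomposesTo (twist φ x) (fun k => (ℳ (q - s - wt k) : Set M)) (ℳ' q : Set M'))
    (c : S →ₐ[ℚ] ℚ) (c' : S' →ₐ[ℚ] ℚ) (hc : ∀ r, c' (j r) = c r)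
    (hc' : ∀ n, n ≠ 0 → ∀ r ∈ 𝒮' n, c' r = 0) (I : Ideal S) (hI : ∀ r, r ∈ I ↔ c r = 0)
    (I' : Ideal S') (hI' : ∀ r, r ∈ I' ↔ c' r = 0) (p : ℕ) (q : ℤ) :
    bettiNumber 𝒮' I' ℳ' p q = bettiNumber 𝒮 I ℳ p (q - s) := by
  let F := standardResolution 𝒮 ℳ
  let G := GradedResolution.baseChange h hφ hφs hφd F
  rw [bettiNumber_eq_redRank c' I' hI' G, bettiNumber_eq_redRank c I hI F]
  have hvec : ∀ (ι : Type) (y : ι →₀ S), redVec c' ι (extVec j.toRingHom ι y) = redVec c ι y := by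
    intro ι y
    ext b
    exact hc _
  -- Both resolutions have the same matrices, with entries in `S`, and `c'` restricts to `c` there.
  have hmap : ∀ p, redMap c' (G.d p) = redMap c (F.d p) := by
    intro p
    unfold redMap
    congr 1
    funext b
    rw [← hvec]
    congr 1
    exact extMap_single _ _ _
  have hcyc : ∀ p, G.redCycles c' p = F.redCycles c p := by
    intro p
    cases p with
    | zero => rfl
    | succ p => simp only [GradedResolution.redCycles, hmap]; rfl
  have hN : (freeDeg 𝒮' (G.deg p) q).map (redVec c' (G.gens p)) =
      (freeDeg 𝒮 (F.deg p) (q - s)).map (redVec c (F.gens p)) := by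
    apply le_antisymm
    · rintro _ ⟨y, hy, rfl⟩
      change F.gens p →₀ S' at y
      change redVec c' (F.gens p) y ∈ _
      -- After reduction only coordinates of degree zero survive, so each entry may be replaced by
      -- its constant `c' (y b)`, which already lives in `S`.
      refine ⟨Finsupp.mapRange (fun r => algebraMap ℚ S (c' r)) (by simp) y, fun b => ?_, ?_⟩
      · rw [Finsupp.mapRange_apply]
        by_cases hb : q - s - F.deg p b = 0
        · rw [hb]
          exact algebraMap_mem_deg_zero _
        · have h0 : c' (y b) = 0 := by
            refine hc' (q - (F.deg p b + s)) (fun h => hb ?_) _ (hy b)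
            rw [← h]
            ring
          rw [h0, map_zero]
          exact zero_mem _
      · ext b
        rw [redVec_apply, redVec_apply, Finsupp.mapRange_apply, AlgHom.commutes]
        rfl
    · rintro _ ⟨y, hy, rfl⟩
      refine ⟨extVec j.toRingHom _ y, fun b => ?_, hvec _ y⟩
      have := h.map_mem (hy b)
      change _ ∈ 𝒮' (q - (F.deg p b + s))
      rwa [add_comm, ← sub_sub]
  refine rank_part_eq_of_equiv _ _ _ _ _ _ (LinearEquiv.refl ℚ (F.gens p →₀ ℚ)) (fun z => ?_)
    (fun z => ?_) (fun z => ?_)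
  · exact (SetLike.ext_iff.1 (hcyc p) z).symm
  · exact (SetLike.ext_iff.1 (congrArg LinearMap.range (hmap p)) z).symm
  · exact (SetLike.ext_iff.1 hN z).symm

end BaseChange

/-! ### Betti numbers over a graded ring concentrated in degree zero -/

section Trivial

variable {S M : Type} [CommRing S] [Algebra ℚ S] {𝒮 : ℤ → Submodule ℚ S}
  [SetLike.GradedMonoid 𝒮]
  [AddCommGroup M] [Module S M] [Module ℚ M] [IsScalarTower ℚ S M] (ℳ : ℤ → Submodule ℚ M)
  {c : S →ₐ[ℚ] ℚ} (hS : ∀ r, algebraMap ℚ S (c r) = r) (hc : ∀ n, n ≠ 0 → ∀ r ∈ 𝒮 n, c r = 0)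

/-- The union of bases of the homogeneous components. -/
abbrev BasisGens : Type := Σ i : ℤ, Module.Basis.ofVectorSpaceIndex ℚ (ℳ i)

/-- The elements of the union of bases of the homogeneous components. -/
def basisGen (b : BasisGens ℳ) : M := (Module.Basis.ofVectorSpace ℚ (ℳ b.1) b.2 : M)

/-- The inclusion of the basis in degree `q`. -/
def basisIncl (q : ℤ) (b : Module.Basis.ofVectorSpaceIndex ℚ (ℳ q)) : BasisGens ℳ := ⟨q, b⟩

theorem basisIncl_injective (q : ℤ) : Function.Injective (basisIncl ℳ q) :=
  fun _ _ h => eq_of_heq (Sigma.mk.inj h).2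

/-- The restriction of a finitely supported function to the basis in degree `q`. -/
def basisPart (q : ℤ) (y : BasisGens ℳ →₀ ℚ) : Module.Basis.ofVectorSpaceIndex ℚ (ℳ q) →₀ ℚ :=
  Finsupp.comapDomain (basisIncl ℳ q) y (basisIncl_injective ℳ q).injOn

theorem linearCombination_basisIncl {q : ℤ} (z : Module.Basis.ofVectorSpaceIndex ℚ (ℳ q) →₀ ℚ) :
    Finsupp.linearCombination ℚ (basisGen ℳ) (Finsupp.mapDomain (basisIncl ℳ q) z) =
      ((Module.Basis.ofVectorSpace ℚ (ℳ q)).repr.symm z : M) := by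
  rw [Finsupp.linearCombination_mapDomain, Module.Basis.repr_symm_apply, ← Submodule.subtype_apply,
    Finsupp.apply_linearCombination]
  rfl

include hS in
-- By `hS` every scalar equals its augmentation, so `S`-linear combinations are rational ones.
theorem linearCombination_eq_redVec (y : BasisGens ℳ →₀ S) :
    Finsupp.linearCombination S (basisGen ℳ) y =
      Finsupp.linearCombination ℚ (basisGen ℳ) (redVec c _ y) := by
  induction y using Finsupp.induction_linear with
  | zero => simp
  | add a b ha hb => simp only [map_add, ha, hb]
  | single b r =>
    rw [redVec_single, Finsupp.linearCombination_single, Finsupp.linearCombination_single]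
    conv_lhs => rw [← hS r, algebraMap_smul]

omit [SetLike.GradedMonoid 𝒮] [Module S M] [IsScalarTower ℚ S M] in
include hc in
-- In a vector of degree `q`, the coefficient of a generator of degree `i` has degree `q - i` and is
-- killed by `c` unless `i = q`. Only the basis of `ℳ q` contributes.
theorem linearCombination_basisPart {q : ℤ} {y : BasisGens ℳ →₀ S}
    (hy : y ∈ freeDeg 𝒮 (fun b => b.1) q) :
    Finsupp.linearCombination ℚ (basisGen ℳ) (redVec c _ y) =
      ((Module.Basis.ofVectorSpace ℚ (ℳ q)).repr.symm (basisPart ℳ q (redVec c _ y)) : M) := by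
  have h : redVec c _ y =
      Finsupp.mapDomain (basisIncl ℳ q) (basisPart ℳ q (redVec c _ y)) := by
    rw [basisPart, Finsupp.mapDomain_comapDomain _ (basisIncl_injective ℳ q)]
    rintro ⟨i, b⟩ hb
    by_cases hi : i = q
    · subst hi
      exact ⟨b, rfl⟩
    · rw [Finset.mem_coe, Finsupp.mem_support_iff, redVec_apply] at hb
      exact absurd (hc (q - i) (by omega) _ (hy ⟨i, b⟩)) hb
  conv_lhs => rw [h, linearCombination_basisIncl]

omit [SetLike.GradedMonoid 𝒮] in
include hS hc in
-- Linear independence inside the single component `ℳ q` suffices; relations between different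
-- components play no role.
theorem eq_zero_of_linearCombination_eq_zero {q : ℤ} {y : BasisGens ℳ →₀ S}
    (hy : y ∈ freeDeg 𝒮 (fun b => b.1) q)
    (h : Finsupp.linearCombination S (basisGen ℳ) y = 0) : y = 0 := by
  rw [linearCombination_eq_redVec ℳ hS, linearCombination_basisPart ℳ hc hy] at h
  have h1 : basisPart ℳ q (redVec c _ y) = 0 :=
    (LinearEquiv.map_eq_zero_iff _).1 ((Submodule.coe_eq_zero).1 h)
  ext ⟨i, b⟩
  by_cases hi : i = q
  · subst hi
    have : c (y ⟨i, b⟩) = 0 := DFunLike.congr_fun h1 b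
    rw [← hS (y _), this, map_zero, Finsupp.zero_apply]
  · rw [← hS (y _), hc (q - i) (by omega) _ (hy ⟨i, b⟩), map_zero, Finsupp.zero_apply]

/-- The resolution of length zero given by bases of the homogeneous components. -/
def basisResolution : GradedResolution 𝒮 ℳ where
  gens p := match p with
    | 0 => BasisGens ℳ
    | _ + 1 => Empty
  deg p := match p with
    | 0 => fun b => b.1
    | _ + 1 => fun b => b.elim
  d _ := 0
  ε := Finsupp.linearCombination S (basisGen ℳ)
  d_deg _ b := b.elim
  ε_deg b := by
    rw [Finsupp.linearCombination_single, one_smul]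
    exact (Module.Basis.ofVectorSpace ℚ (ℳ b.1) b.2).2
  cycles p := match p with
    | 0 => LinearMap.ker (Finsupp.linearCombination S (basisGen ℳ))
    | _ + 1 => ⊤
  cycles_zero := rfl
  cycles_succ _ := LinearMap.ker_zero.symm
  d_mem _ y := zero_mem _
  ε_surj q m hm := by
    let z := Finsupp.mapDomain (basisIncl ℳ q) ((Module.Basis.ofVectorSpace ℚ (ℳ q)).repr ⟨m, hm⟩)
    have hz : redVec c (BasisGens ℳ) (Finsupp.mapRange (algebraMap ℚ S) (map_zero _) z) = z := by
      ext b
      simp [redVec_apply]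
    refine ⟨Finsupp.mapRange (algebraMap ℚ S) (map_zero _) z, ?_, ?_⟩
    · rintro ⟨i, b⟩
      rw [Finsupp.mapRange_apply]
      by_cases hi : i = q
      · subst hi
        rw [sub_self]
        exact algebraMap_mem_deg_zero _
      · rw [Finsupp.mapDomain_of_notMem_range, map_zero]
        · exact zero_mem _
        · rintro ⟨b', hb'⟩
          exact hi (congrArg Sigma.fst hb').symm
    · rw [linearCombination_eq_redVec ℳ hS, hz, linearCombination_basisIncl,
        LinearEquiv.symm_apply_apply]
  exact p q y hy hq := by
    cases p with
    | zero => exact ⟨0, zero_mem _, (eq_zero_of_linearCombination_eq_zero ℳ hS hc hq hy).symm⟩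
    | succ p => exact ⟨0, zero_mem _, by ext b; exact b.elim⟩

include hS hc in
theorem bettiNumber_succ_eq_zero (I : Ideal S) (hI : ∀ r, r ∈ I ↔ c r = 0) (p : ℕ) (q : ℤ) :
    bettiNumber 𝒮 I ℳ (p + 1) q = 0 := by
  rw [bettiNumber_eq_redRank c I hI (basisResolution ℳ hS hc)]
  have : Subsingleton ((basisResolution ℳ hS hc).gens (p + 1) →₀ ℚ) :=
    inferInstanceAs (Subsingleton (Empty →₀ ℚ))
  have : ∀ a : SubQuot.part ℚ ((basisResolution ℳ hS hc).redCycles c (p + 1))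
      (LinearMap.range (redMap c ((basisResolution ℳ hS hc).d (p + 1))))
      ((freeDeg 𝒮 ((basisResolution ℳ hS hc).deg (p + 1)) q).map (redVec c _)), a = 0 := by
    intro a
    obtain ⟨z, rfl⟩ := SubQuot.toPart_surjective _ _ _ a
    rw [show z = 0 from Subtype.ext (Subtype.ext (Subsingleton.elim _ _)), map_zero]
  have := subsingleton_of_forall_eq _ this
  exact rank_subsingleton' ..

include hS hc in
-- In the basis resolution every vector of degree zero is a cycle and the boundaries vanish, so the
-- Betti number is the dimension of the space `N` of reduced vectors of degree `q`, which `u`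
-- identifies with `ℳ q`.
theorem bettiNumber_zero_eq_rank (I : Ideal S) (hI : ∀ r, r ∈ I ↔ c r = 0) (q : ℤ) :
    bettiNumber 𝒮 I ℳ 0 q = Module.rank ℚ (ℳ q) := by
  rw [bettiNumber_eq_redRank c I hI (basisResolution ℳ hS hc)]
  let N : Submodule ℚ (BasisGens ℳ →₀ ℚ) := (freeDeg 𝒮 (fun b => b.1) q).map (redVec c _)
  let u := (Finsupp.linearCombination ℚ (basisGen ℳ)).domRestrict N
  have hu : Function.Injective u := by
    refine (injective_iff_map_eq_zero _).2 ?_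
    rintro ⟨_, y, hy, rfl⟩ h
    refine Subtype.ext ?_
    change Finsupp.linearCombination ℚ (basisGen ℳ) (redVec c _ y) = 0 at h
    rw [← linearCombination_eq_redVec ℳ hS] at h
    change redVec c _ y = 0
    rw [eq_zero_of_linearCombination_eq_zero ℳ hS hc hy h, map_zero]
  have hr : LinearMap.range u = ℳ q := by
    apply le_antisymm
    · rintro _ ⟨⟨_, y, hy, rfl⟩, rfl⟩
      change Finsupp.linearCombination ℚ (basisGen ℳ) (redVec c _ y) ∈ _
      rw [linearCombination_basisPart ℳ hc hy]
      exact Subtype.mem _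
    · intro m hm
      obtain ⟨y, hy, rfl⟩ := (basisResolution ℳ hS hc).ε_surj q m hm
      exact ⟨⟨redVec c _ y, y, hy, rfl⟩, (linearCombination_eq_redVec ℳ hS y).symm⟩
  have h2 : Module.rank ℚ N = Module.rank ℚ (ℳ q) := by
    rw [(LinearEquiv.ofInjective u hu).rank_eq, hr]
  rw [← h2]
  have hW : LinearMap.range (redMap c ((basisResolution ℳ hS hc).d 0)) = ⊥ := by
    rw [LinearMap.range_eq_bot]
    ext b
    exact b.elim
  let v : ↥(N.comap (((basisResolution ℳ hS hc).redCycles c 0).subtype.restrictScalars ℚ)) →ₗ[ℚ] N :=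
    { toFun := fun z => ⟨z.1.1, z.2⟩
      map_add' := fun _ _ => rfl
      map_smul' := fun _ _ => rfl }
  have hv : Function.Bijective v :=
    ⟨fun a b h => Subtype.ext (Subtype.ext
      (congrArg (fun w : N => (w : BasisGens ℳ →₀ ℚ)) h :)),
      fun z => ⟨⟨⟨z.1, trivial⟩, z.2⟩, rfl⟩⟩
  rw [← (LinearEquiv.ofBijective v hv).rank_eq]
  refine ((LinearEquiv.ofBijective (SubQuot.toPart _ _ _) ⟨?_, SubQuot.toPart_surjective _ _ _⟩).rank_eq).symm
  refine (injective_iff_map_eq_zero _).2 fun z hz => ?_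
  rw [SubQuot.toPart_eq_zero, hW, Submodule.mem_bot] at hz
  exact Subtype.ext (Subtype.ext hz)

end Trivial

/-! ### Polynomial rings as free extensions of the rings of differences -/

section Polynomials

variable (V : Type)

instance : SetLike.GradedMonoid (polyDeg V) where
  one_mem := MvPolynomial.isWeightedHomogeneous_one ℚ _
  mul_mem _ _ _ _ hi hj := MvPolynomial.IsWeightedHomogeneous.mul hi hj

instance : SetLike.GradedMonoid (diffDeg V) where
  one_mem := SetLike.one_mem_graded (polyDeg V)
  mul_mem _ _ _ _ hi hj := SetLike.mul_mem_graded (A := polyDeg V) hi hj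

/-- The grading of the polynomials over the ring of differences, with a variable of degree `2`. -/
def diffPolyDeg (q : ℤ) : Submodule ℚ (Polynomial (DiffRing V)) where
  carrier := {g | ∀ n : ℕ, g.coeff n ∈ diffDeg V (q - 2 * n)}
  add_mem' hf hg n := by
    rw [Polynomial.coeff_add]
    exact add_mem (hf n) (hg n)
  zero_mem' n := by
    rw [Polynomial.coeff_zero]
    exact zero_mem _
  smul_mem' r f hf n := by
    rw [Polynomial.coeff_smul]
    exact Submodule.smul_mem _ _ (hf n)

instance : SetLike.GradedMonoid (diffPolyDeg V) where
  one_mem n := by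
    rw [Polynomial.coeff_one]
    split_ifs with h
    · subst h
      exact SetLike.one_mem_graded (diffDeg V)
    · exact zero_mem _
  mul_mem a b f g hf hg n := by
    rw [Polynomial.coeff_mul]
    refine sum_mem fun ij hij => ?_
    have := SetLike.mul_mem_graded (hf ij.1) (hg ij.2)
    rw [Finset.HasAntidiagonal.mem_antidiagonal] at hij
    convert this using 2
    rw [← hij]
    push_cast
    ring

variable {V} (v₀ : V)

/-- The expansion of a polynomial in powers of `X_{v₀}` with coefficients in the ring of
differences. -/
def diffExpand : MvPolynomial V ℚ →ₐ[ℚ] Polynomial (DiffRing V) :=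
  MvPolynomial.aeval fun v => Polynomial.C (diffX v v₀) + Polynomial.X

theorem diffExpand_X (v : V) :
    diffExpand v₀ (MvPolynomial.X v) = Polynomial.C (diffX v v₀) + Polynomial.X := by
  simp [diffExpand]

theorem diffX_self (v : V) : diffX v v = 0 := by
  ext1
  simp [diffX]

/-- In `X_v - X_w = (X_v - X_{v₀}) - (X_w - X_{v₀})` the polynomial variable cancels, so the
generators of the ring of differences, and hence all its elements, expand to constants. -/
theorem diffExpand_coe (a : DiffRing V) : diffExpand v₀ a = Polynomial.C a := by
  obtain ⟨a, ha⟩ := a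
  induction ha using Algebra.adjoin_induction with
  | mem a ha =>
    obtain ⟨v, w, rfl⟩ := ha
    change diffExpand v₀ (MvPolynomial.X v - MvPolynomial.X w) = Polynomial.C (diffX v w)
    have : diffX v w = diffX v v₀ - diffX w v₀ := by
      ext1
      simp [diffX]
    rw [map_sub, diffExpand_X, diffExpand_X, this, map_sub]
    ring
  | algebraMap r =>
    change diffExpand v₀ (algebraMap ℚ _ r) = _
    rw [AlgHom.commutes]
    rfl
  | add a b _ _ ha hb =>
    change diffExpand v₀ (a + b) = _
    rw [map_add]
    erw [ha, hb]
    rw [← map_add]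
    rfl
  | mul a b _ _ ha hb =>
    change diffExpand v₀ (a * b) = _
    rw [map_mul]
    erw [ha, hb]
    rw [← map_mul]
    rfl

theorem aeval_diffExpand (f : MvPolynomial V ℚ) :
    Polynomial.aeval (MvPolynomial.X v₀ : MvPolynomial V ℚ) (diffExpand v₀ f) = f := by
  have : ((Polynomial.aeval (R := DiffRing V) (MvPolynomial.X v₀ : MvPolynomial V ℚ)).restrictScalars
      ℚ).comp (diffExpand v₀) = AlgHom.id ℚ _ := by
    apply MvPolynomial.algHom_ext
    intro v
    simp only [AlgHom.comp_apply, diffExpand_X, map_add, AlgHom.restrictScalars_apply,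
      Polynomial.aeval_C, Polynomial.aeval_X, AlgHom.id_apply]
    exact sub_add_cancel _ _
  exact DFunLike.congr_fun this f

theorem X_mem_polyDeg (v : V) : (MvPolynomial.X v : MvPolynomial V ℚ) ∈ polyDeg V 2 :=
  MvPolynomial.isWeightedHomogeneous_X ℚ _ v

theorem diffX_mem_diffDeg (v w : V) : diffX v w ∈ diffDeg V 2 := by
  change (MvPolynomial.X v - MvPolynomial.X w : MvPolynomial V ℚ) ∈ polyDeg V 2
  exact sub_mem (X_mem_polyDeg v) (X_mem_polyDeg w)

/-- The claim is clear for variables, passes to monomials by multiplicativity of the grading, and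
then to sums of monomials of weight `q`. -/
theorem diffExpand_mem {q : ℤ} {f : MvPolynomial V ℚ} (hf : f ∈ polyDeg V q) :
    diffExpand v₀ f ∈ diffPolyDeg V q := by
  have hX : ∀ v, diffExpand v₀ (MvPolynomial.X v) ∈ diffPolyDeg V 2 := by
    intro v n
    rw [diffExpand_X, Polynomial.coeff_add, Polynomial.coeff_C, Polynomial.coeff_X]
    refine add_mem ?_ ?_
    · split_ifs with h
      · subst h
        exact diffX_mem_diffDeg v v₀
      · exact zero_mem _
    · split_ifs with h
      · subst h
        exact SetLike.one_mem_graded (diffDeg V)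
      · exact zero_mem _
  have hmon : ∀ d : V →₀ ℕ, diffExpand v₀ (MvPolynomial.monomial d 1) ∈
      diffPolyDeg V (Finsupp.weight (fun _ => (2 : ℤ)) d) := by
    intro d
    induction d using Finsupp.induction_linear with
    | zero =>
      rw [map_zero, ← MvPolynomial.one_def, map_one]
      exact SetLike.one_mem_graded _
    | add a b ha hb =>
      have : (MvPolynomial.monomial (a + b) 1 : MvPolynomial V ℚ) =
          MvPolynomial.monomial a 1 * MvPolynomial.monomial b 1 := by
        simp [MvPolynomial.monomial_mul]
      rw [this, map_mul, map_add]
      exact SetLike.mul_mem_graded ha hb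
    | single v n =>
      rw [← MvPolynomial.X_pow_eq_monomial, map_pow, Finsupp.weight_single]
      exact SetLike.pow_mem_graded n (hX v)
  rw [← MvPolynomial.support_sum_monomial_coeff f, map_sum]
  refine sum_mem fun d hd => ?_
  have h1 : Finsupp.weight (fun _ => (2 : ℤ)) d = q := hf (MvPolynomial.mem_support_iff.1 hd)
  have h2 : (MvPolynomial.monomial d (MvPolynomial.coeff d f)) =
      MvPolynomial.coeff d f • MvPolynomial.monomial d 1 := by
    rw [MvPolynomial.smul_monomial, smul_eq_mul, mul_one]
  rw [h2, map_smul, ← h1]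
  exact Submodule.smul_mem _ _ (hmon d)

theorem assemble_twist_eq_aeval (g : Polynomial (DiffRing V)) (v : ℕ →₀ DiffRing V)
    (hv : ∀ n, v n = g.coeff n) :
    assemble (twist (DiffRing V).val.toRingHom.toAddMonoidHom
      (fun n : ℕ => (MvPolynomial.X v₀ : MvPolynomial V ℚ) ^ n)) v =
    Polynomial.aeval (MvPolynomial.X v₀ : MvPolynomial V ℚ) g := by
  rw [Polynomial.aeval_def, Polynomial.eval₂_def, Polynomial.sum]
  have : v.support = g.support := by
    ext n
    rw [Finsupp.mem_support_iff, Polynomial.mem_support_iff, hv]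
  simp only [assemble, Finsupp.liftAddHom_apply, Finsupp.sum, this]
  refine Finset.sum_congr rfl fun n _ => ?_
  rw [hv, twist_apply, smul_eq_mul, mul_comm]
  rfl

/-- Expansion in powers of `X_{v₀}` and evaluation at `X_{v₀}` are mutually inverse and respect
degrees: `ℚ[X_v]` is a polynomial ring in `X_{v₀}` over the ring of differences. -/
theorem freeExtension_diffRing :
    FreeExtension (diffDeg V) (polyDeg V) (DiffRing V).val
      (fun n : ℕ => (MvPolynomial.X v₀ : MvPolynomial V ℚ) ^ n) (fun n => 2 * n) where
  dec := by
    -- Expanding an assembled sum returns its coefficients, since constants expand to constants and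
    -- `X_{v₀}` to the polynomial variable.
    have hcoeff : ∀ (v : ℕ →₀ DiffRing V), ∀ n, v n = (diffExpand v₀
        (assemble (twist (DiffRing V).val.toRingHom.toAddMonoidHom
          (fun n : ℕ => (MvPolynomial.X v₀ : MvPolynomial V ℚ) ^ n)) v)).coeff n := by
      intro v n
      induction v using Finsupp.induction_linear with
      | zero => simp
      | add a b ha hb => rw [map_add, map_add, Polynomial.coeff_add, ← ha, ← hb, Finsupp.add_apply]
      | single k a =>
        have : (DiffRing V).val.toRingHom.toAddMonoidHom a = (a : MvPolynomial V ℚ) := rfl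
        rw [assemble_single, twist_apply, smul_eq_mul, this, map_mul, map_pow, diffExpand_coe,
          diffExpand_X, diffX_self, map_zero, zero_add, mul_comm, Polynomial.coeff_C_mul_X_pow,
          Finsupp.single_apply]
        simp only [eq_comm]
    refine ⟨(injective_iff_map_eq_zero _).2 fun v hv => ?_, fun f => ?_⟩
    · ext1 n
      rw [hcoeff, hv]
      simp
    · refine ⟨Finsupp.onFinset (diffExpand v₀ f).support (diffExpand v₀ f).coeff
        fun n hn => Polynomial.mem_support_iff.2 hn, ?_⟩
      rw [assemble_twist_eq_aeval v₀ (diffExpand v₀ f) _ (fun n => Finsupp.onFinset_apply),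
        aeval_diffExpand]
  decDeg q :=
    { mem := by
        intro n a ha
        have h1 : (MvPolynomial.X v₀ : MvPolynomial V ℚ) ^ n ∈ polyDeg V (n • 2) :=
          SetLike.pow_mem_graded n (X_mem_polyDeg v₀)
        have h2 := SetLike.mul_mem_graded (A := polyDeg V) h1 ha
        rw [nsmul_eq_mul, mul_comm, add_sub_cancel] at h2
        exact h2
      exists_eq := fun f hf =>
        ⟨Finsupp.onFinset (diffExpand v₀ f).support (diffExpand v₀ f).coeff
          fun n hn => Polynomial.mem_support_iff.2 hn, diffExpand_mem v₀ hf, by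
          rw [assemble_twist_eq_aeval v₀ (diffExpand v₀ f) _ (fun n => Finsupp.onFinset_apply),
        aeval_diffExpand]⟩ }
  one := ⟨0, by simp⟩

variable (V)

/-- The augmentation of the polynomial ring. -/
def polyAug : MvPolynomial V ℚ →ₐ[ℚ] ℚ := MvPolynomial.aeval fun _ => 0

/-- The augmentation of the ring of differences. -/
def diffAug : DiffRing V →ₐ[ℚ] ℚ := (polyAug V).comp (DiffRing V).val

variable {V}

theorem polyAug_eq_zero {n : ℤ} (hn : n ≠ 0) {f : MvPolynomial V ℚ} (hf : f ∈ polyDeg V n) :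
    polyAug V f = 0 := by
  rw [polyAug, MvPolynomial.aeval_zero']
  by_contra h
  have h0 : MvPolynomial.coeff 0 f ≠ 0 := fun h' => h (by
    rw [MvPolynomial.constantCoeff_eq, h', map_zero])
  have := hf h0
  rw [map_zero] at this
  exact hn this.symm

theorem diffAug_eq_zero {n : ℤ} (hn : n ≠ 0) {f : DiffRing V} (hf : f ∈ diffDeg V n) :
    diffAug V f = 0 :=
  polyAug_eq_zero hn hf

theorem mem_span_X_iff (f : MvPolynomial V ℚ) :
    f ∈ Ideal.span (Set.range MvPolynomial.X) ↔ polyAug V f = 0 := by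
  constructor
  · intro hf
    refine (Ideal.span_le (I := RingHom.ker (polyAug V))).2 ?_ hf
    rintro _ ⟨v, rfl⟩
    simp [RingHom.mem_ker, polyAug]
  · intro hf
    -- The induction needs a statement about all `f`: subtracting the constant term always lands in
    -- the ideal.
    suffices f - MvPolynomial.C (polyAug V f) ∈
        Ideal.span (Set.range (MvPolynomial.X : V → MvPolynomial V ℚ)) by
      rwa [hf, map_zero, sub_zero] at this
    clear hf
    induction f using MvPolynomial.induction_on with
    | C r => simp [polyAug]
    | add f g hf hg =>
      rw [map_add, map_add, add_sub_add_comm]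
      exact add_mem hf hg
    | mul_X f v hf =>
      have : polyAug V (MvPolynomial.X v) = 0 := by simp [polyAug]
      rw [map_mul, this, mul_zero, map_zero, sub_zero]
      exact Ideal.mul_mem_left _ _ (Ideal.subset_span ⟨v, rfl⟩)

theorem diffAug_diffX (v w : V) : diffAug V (diffX v w) = 0 := by
  change polyAug V (MvPolynomial.X v - MvPolynomial.X w) = 0
  simp [polyAug]

theorem mem_span_diffX_iff (f : DiffRing V) :
    f ∈ Ideal.span {f | ∃ v w : V, f = diffX v w} ↔ diffAug V f = 0 := by
  constructor
  · intro hf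
    refine (Ideal.span_le (I := RingHom.ker (diffAug V))).2 ?_ hf
    rintro _ ⟨v, w, rfl⟩
    exact diffAug_diffX v w
  · intro hf
    suffices f - algebraMap ℚ _ (diffAug V f) ∈ Ideal.span {f | ∃ v w : V, f = diffX v w} by
      rwa [hf, map_zero, sub_zero] at this
    clear hf
    obtain ⟨f, hf⟩ := f
    induction hf using Algebra.adjoin_induction with
    | mem a ha =>
      obtain ⟨v, w, rfl⟩ := ha
      have h := diffAug_diffX v w
      unfold diffX at h
      rw [h, map_zero, sub_zero]
      exact Ideal.subset_span ⟨v, w, rfl⟩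
    | algebraMap r =>
      have : (⟨algebraMap ℚ _ r, Subalgebra.algebraMap_mem _ r⟩ : DiffRing V) =
        algebraMap ℚ _ r := rfl
      rw [this, AlgHom.commutes]
      simp
    | add a b hma hmb ha hb =>
      have : (⟨a + b, add_mem hma hmb⟩ : DiffRing V) = ⟨a, hma⟩ + ⟨b, hmb⟩ := rfl
      rw [this, map_add, map_add, add_sub_add_comm]
      exact add_mem ha hb
    | mul a b hma hmb ha hb =>
      have : (⟨a * b, mul_mem hma hmb⟩ : DiffRing V) = ⟨a, hma⟩ * ⟨b, hmb⟩ := rfl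
      rw [this, map_mul, map_mul]
      -- With `ε` the augmentation, `ab - ε(a)ε(b) = (a - ε(a)) b + ε(a) (b - ε(b))`.
      have h := add_mem (Ideal.mul_mem_right ⟨b, hmb⟩ _ ha)
        (Ideal.mul_mem_left _ (algebraMap ℚ (DiffRing V) (diffAug V ⟨a, hma⟩)) hb)
      convert h using 1
      ring

/-- With at most one variable all differences vanish, so the augmentation ideal is zero and the ring
is `ℚ`. -/
theorem algebraMap_diffAug [Subsingleton V] (f : DiffRing V) :
    algebraMap ℚ _ (diffAug V f) = f := by
  have h : f - algebraMap ℚ _ (diffAug V f) ∈ Ideal.span {f | ∃ v w : V, f = diffX v w} :=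
    (mem_span_diffX_iff _).2 (by rw [map_sub, AlgHom.commutes]; exact sub_self _)
  have h0 : Ideal.span {f | ∃ v w : V, f = diffX v w} = ⊥ := by
    rw [Ideal.span_eq_bot]
    rintro _ ⟨v, w, rfl⟩
    rw [Subsingleton.elim w v, diffX_self]
  rw [h0, Ideal.mem_bot, sub_eq_zero] at h
  exact h.symm

end Polynomials

/-! ### Quotients of free extensions -/

section Quotients

variable {κ S S' Q Q' : Type} [CommRing S] [CommRing S'] [Algebra ℚ S] [Algebra ℚ S']
  [CommRing Q] [CommRing Q'] [Algebra ℚ Q] [Algebra ℚ Q']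
  {𝒮 : ℤ → Submodule ℚ S} {𝒮' : ℤ → Submodule ℚ S'} {j : S →ₐ[ℚ] S'}

theorem FreeExtension.ideal_map {x : κ → S'} {wt : κ → ℤ} (h : FreeExtension 𝒮 𝒮' j x wt)
    (I : Ideal S) :
    DecomposesTo (twist j.toRingHom.toAddMonoidHom x) (fun _ => (I : Set S))
      (I.map j : Set S') where
  mem k v hv := Ideal.mul_mem_left _ _ (Ideal.mem_map_of_mem j hv)
  exists_eq := by
    let t := twist j.toRingHom.toAddMonoidHom x
    -- The multiplier `a` absorbs multiplication by `S'` in the induction. On a generator `j i`,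
    -- expanding `a` in the basis moves `i` into the coordinates.
    suffices H : ∀ w ∈ Ideal.span (j '' (I : Set S)), ∀ a : S',
        ∃ v : κ →₀ S, (∀ k, v k ∈ I) ∧ assemble t v = a * w by
      intro w hw
      obtain ⟨v, hv, e⟩ := H w hw 1
      exact ⟨v, hv, by rw [one_mul] at e; exact e⟩
    intro w hw
    induction hw using Submodule.span_induction with
    | mem w hw =>
      obtain ⟨i, hi, rfl⟩ := hw
      intro a
      obtain ⟨u, rfl⟩ := h.dec.2 a
      refine ⟨Finsupp.mapRange.addMonoidHom (AddMonoidHom.mulRight i) u,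
        fun k => Ideal.mul_mem_left _ _ hi, ?_⟩
      rw [← map_assemble (t := t) (g := AddMonoidHom.mulRight (j i))]
      · rfl
      · intro k v
        change (x k * j v) * j i = x k * j (v * i)
        rw [map_mul, mul_assoc]
    | zero => exact fun a => ⟨0, by simp, by simp⟩
    | add w₁ w₂ _ _ h1 h2 =>
      intro a
      obtain ⟨v₁, hv₁, e₁⟩ := h1 a
      obtain ⟨v₂, hv₂, e₂⟩ := h2 a
      exact ⟨v₁ + v₂, fun k => add_mem (hv₁ k) (hv₂ k), by rw [map_add, e₁, e₂, mul_add]⟩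
    | smul b w _ hw =>
      intro a
      obtain ⟨v, hv, e⟩ := hw (a * b)
      exact ⟨v, hv, by rw [e, smul_eq_mul, mul_assoc]⟩

/-- Dividing `S'` by the extension of an ideal of `S` divides each coordinate by that ideal. -/
theorem FreeExtension.quotient {x : κ → S'} {wt : κ → ℤ} (h : FreeExtension 𝒮 𝒮' j x wt)
    {π : S →ₐ[ℚ] Q} {π' : S' →ₐ[ℚ] Q'} (hπ : Function.Surjective π) (hπ' : Function.Surjective π')
    {j' : Q →ₐ[ℚ] Q'} (hj : ∀ r, j' (π r) = π' (j r))
    (hker : RingHom.ker π' = (RingHom.ker π).map j) :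
    FreeExtension (fun q => (𝒮 q).map π.toLinearMap) (fun q => (𝒮' q).map π'.toLinearMap) j'
      (fun k => π' (x k)) wt := by
  have hc : ∀ k v, π'.toRingHom.toAddMonoidHom (twist j.toRingHom.toAddMonoidHom x k v) =
      twist j'.toRingHom.toAddMonoidHom (fun k => π' (x k)) k (π.toRingHom.toAddMonoidHom v) := by
    intro k v
    change π' (x k * j v) = π' (x k) * j' (π v)
    rw [map_mul, hj]
  refine ⟨h.dec.of_surjective hc hπ hπ' ?_, fun q => (h.decDeg q).image hc, ?_⟩
  · have := h.ideal_map (RingHom.ker π)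
    rw [← hker] at this
    exact this
  · obtain ⟨k, hk, hk'⟩ := h.one
    exact ⟨k, by rw [hk, map_one], hk'⟩

/-- Here `S'` is a polynomial ring `S[x₀]`, and setting `x₀ = 0` gives back `S`. The isomorphism is
recorded as a free extension with the single basis element `1`. -/
theorem FreeExtension.quotient_variable {x₀ : S'} {wt : ℕ → ℤ}
    (h : FreeExtension 𝒮 𝒮' j (fun n : ℕ => x₀ ^ n) wt) (hwt : wt 0 = 0)
    {π : S' →ₐ[ℚ] Q} (hπ : Function.Surjective π) (hker : RingHom.ker π = Ideal.span {x₀}) :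
    FreeExtension 𝒮 (fun q => (𝒮' q).map π.toLinearMap) (π.comp j) (fun _ : Unit => 1)
      (fun _ => 0) := by
  have hx : π x₀ = 0 := by
    rw [← RingHom.mem_ker, hker]
    exact Ideal.mem_span_singleton_self x₀
  have h1 : ∀ u, π (assemble (twist j.toRingHom.toAddMonoidHom (fun n : ℕ => x₀ ^ n)) u) =
      π (j (u 0)) := by
    intro u
    induction u using Finsupp.induction_linear with
    | zero => simp
    | add a b ha hb => rw [map_add, map_add, ha, hb, Finsupp.add_apply, map_add, map_add]
    | single n a =>
      rw [assemble_single]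
      change π (x₀ ^ n * j a) = _
      rw [map_mul, map_pow, hx]
      rcases Nat.eq_zero_or_pos n with rfl | hn
      · simp
      · rw [zero_pow hn.ne', zero_mul, Finsupp.single_eq_of_ne hn.ne, map_zero, map_zero]
  have h2 : ∀ v : Unit →₀ S, assemble (twist (π.comp j).toRingHom.toAddMonoidHom
      (fun _ : Unit => (1 : Q))) v = π (j (v ())) := by
    intro v
    obtain ⟨r, rfl⟩ : ∃ r, v = Finsupp.single () r := ⟨v (), by ext; simp⟩
    rw [assemble_single, twist_apply, one_smul, Finsupp.single_eq_same]
    rfl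
  refine ⟨⟨(injective_iff_map_eq_zero _).2 fun v hv => ?_, fun w => ?_⟩, fun q => ⟨?_, ?_⟩,
    ⟨(), rfl, rfl⟩⟩
  · rw [h2, ← RingHom.mem_ker, hker, Ideal.mem_span_singleton] at hv
    obtain ⟨r, hr⟩ := hv
    obtain ⟨u, rfl⟩ := h.dec.2 r
    -- Multiplication by `x₀` shifts coefficients by one. A constant divisible by `x₀` is thus zero,
    -- as seen by comparing coefficients at `0`.
    have h3 : x₀ * assemble (twist j.toRingHom.toAddMonoidHom (fun n : ℕ => x₀ ^ n)) u =
        assemble (twist j.toRingHom.toAddMonoidHom (fun n : ℕ => x₀ ^ n))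
          (Finsupp.mapDomain Nat.succ u) := by
      clear hr
      induction u using Finsupp.induction_linear with
      | zero => simp
      | add a b ha hb => rw [map_add, mul_add, ha, hb, Finsupp.mapDomain_add, map_add]
      | single n a =>
        rw [Finsupp.mapDomain_single, assemble_single, assemble_single]
        change x₀ * (x₀ ^ n * j a) = x₀ ^ (n + 1) * j a
        ring
    have h4 : assemble (twist j.toRingHom.toAddMonoidHom (fun n : ℕ => x₀ ^ n))
        (Finsupp.single 0 (v ())) = j (v ()) := by
      rw [assemble_single]
      change x₀ ^ 0 * j _ = _
      rw [pow_zero, one_mul]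
    rw [h3, ← h4] at hr
    have h5 := DFunLike.congr_fun (h.dec.1 hr) 0
    rw [Finsupp.single_eq_same, Finsupp.mapDomain_of_notMem_range] at h5
    · ext
      exact h5
    · rintro ⟨n, hn⟩
      exact Nat.succ_ne_zero n hn
  · obtain ⟨r, rfl⟩ := hπ w
    obtain ⟨u, rfl⟩ := h.dec.2 r
    exact ⟨Finsupp.single () (u 0), by rw [h2, h1, Finsupp.single_eq_same]⟩
  · intro k v hv
    rw [sub_zero] at hv
    rw [twist_apply, one_smul]
    exact ⟨j v, h.map_mem hv, rfl⟩
  · rintro _ ⟨r, hr, rfl⟩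
    obtain ⟨u, hu, rfl⟩ := (h.decDeg q).exists_eq r hr
    refine ⟨Finsupp.single () (u 0), fun k => ?_, ?_⟩
    · have := hu 0
      rw [hwt] at this
      simpa using this
    · rw [h2, Finsupp.single_eq_same]
      exact (h1 u).symm

end Quotients

/-! ### The edge ring and its quotient by a variable over the reduced edge ring. -/

namespace ClosedBraid

variable (B : ClosedBraid)

/-- Each relation is a sum of differences of variables, so it already lives in the ring of
differences. -/
theorem relIdeal_eq_map : B.relIdeal = B.reducedRelIdeal.map (DiffRing B.Edge).val := by
  rw [relIdeal, reducedRelIdeal, Ideal.map_span, ← Set.range_comp]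
  rfl

/-- The inclusion of the reduced edge ring into the edge ring. -/
def redToEdge : B.ReducedEdgeRing →ₐ[ℚ] B.EdgeRing :=
  Ideal.Quotient.liftₐ B.reducedRelIdeal (B.toEdgeRing.comp (DiffRing B.Edge).val) (by
    intro a ha
    refine Ideal.Quotient.eq_zero_iff_mem.2 ?_
    rw [relIdeal_eq_map]
    exact Ideal.mem_map_of_mem _ ha)

theorem toEdgeRing_surjective : Function.Surjective B.toEdgeRing :=
  Ideal.Quotient.mkₐ_surjective ℚ B.relIdeal

theorem toReducedEdgeRing_surjective : Function.Surjective B.toReducedEdgeRing :=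
  Ideal.Quotient.mkₐ_surjective ℚ B.reducedRelIdeal

theorem freeExtension_edgeRing (v₀ : B.Edge) :
    FreeExtension B.reducedEdgeRingDeg B.edgeRingDeg B.redToEdge
      (fun n : ℕ => B.toEdgeRing (MvPolynomial.X v₀) ^ n) (fun n => 2 * n) := by
  have := (freeExtension_diffRing v₀).quotient B.toReducedEdgeRing_surjective
    B.toEdgeRing_surjective (j' := B.redToEdge) (fun _ => rfl) (by
      have h1 : RingHom.ker B.toEdgeRing = B.relIdeal := Ideal.Quotient.mkₐ_ker ℚ B.relIdeal
      have h2 : RingHom.ker B.toReducedEdgeRing = B.reducedRelIdeal :=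
        Ideal.Quotient.mkₐ_ker ℚ B.reducedRelIdeal
      rw [h1, h2, relIdeal_eq_map])
  simp only [map_pow] at this
  exact this

theorem freeExtension_markedEdgeRing (x : B.Edge) :
    FreeExtension B.reducedEdgeRingDeg (B.markedEdgeRingDeg x)
      ((B.toMarkedEdgeRing x).comp B.redToEdge) (fun _ : Unit => 1) (fun _ => 0) :=
  (B.freeExtension_edgeRing x).quotient_variable (by simp)
    (Ideal.Quotient.mkₐ_surjective ℚ (B.markedIdeal x)) (Ideal.Quotient.mkₐ_ker ℚ (B.markedIdeal x))

end ClosedBraid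

/-! ### Free extensions and homology -/

section SubQuotients

variable {κ S S' M M' : Type} [CommRing S] [CommRing S'] {σ : S →+* S'}
  [AddCommGroup M] [Module S M] [AddCommGroup M'] [Module S' M']
  {Z W : Submodule S M} {Z' W' : Submodule S' M'}

/-- The map between subquotients induced by a semilinear map. -/
def SubQuot.map (φ : M →ₛₗ[σ] M') (hZ : ∀ z ∈ Z, φ z ∈ Z') (hW : ∀ z ∈ W, φ z ∈ W') :
    SubQuot Z W →ₛₗ[σ] SubQuot Z' W' :=
  Submodule.mapQ _ _ ((φ.domRestrict Z).codRestrict Z' fun z => hZ z.1 z.2)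
    (fun z hz => hW z.1 hz)

variable {φ : M →ₛₗ[σ] M'} {x : κ → S'} (ht : Decomposes (twist φ.toAddMonoidHom x))
  (hZ : DecomposesTo (twist φ.toAddMonoidHom x) (fun _ => (Z : Set M)) (Z' : Set M'))
  (hW : DecomposesTo (twist φ.toAddMonoidHom x) (fun _ => (W : Set M)) (W' : Set M'))
  (hφZ : ∀ z ∈ Z, φ z ∈ Z') (hφW : ∀ z ∈ W, φ z ∈ W')

/-- The restriction of `twist φ x` to a submodule. -/
def subTwist (x : κ → S') (hφZ : ∀ z ∈ Z, φ z ∈ Z') (k : κ) : Z →+ Z' :=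
  twist ((φ.domRestrict Z).codRestrict Z' fun z => hφZ z.1 z.2).toAddMonoidHom x k

theorem subTwist_coe (k : κ) (v : Z) :
    Z'.subtype.toAddMonoidHom (subTwist x hφZ k v) =
      twist φ.toAddMonoidHom x k (Z.subtype.toAddMonoidHom v) := rfl

theorem mk_subTwist (k : κ) (v : Z) :
    (W'.submoduleOf Z').mkQ.toAddMonoidHom (subTwist x hφZ k v) =
      twist (SubQuot.map φ hφZ hφW).toAddMonoidHom x k
        ((W.submoduleOf Z).mkQ.toAddMonoidHom v) := rfl

include hZ in
theorem decomposesTo_range_subtype :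
    DecomposesTo (twist φ.toAddMonoidHom x) (fun _ => Set.range Z.subtype.toAddMonoidHom)
      (Set.range Z'.subtype.toAddMonoidHom) := by
  have h1 : Set.range Z.subtype.toAddMonoidHom = (Z : Set M) := Subtype.range_coe
  have h2 : Set.range Z'.subtype.toAddMonoidHom = (Z' : Set M') := Subtype.range_coe
  rw [h1, h2]
  exact hZ

include ht hZ in
theorem decomposesTo_preimage {N : κ → Set M} {N' : Set M'}
    (h : DecomposesTo (twist φ.toAddMonoidHom x) N N') (h0 : ∀ k, (0 : M) ∈ N k) :
    DecomposesTo (subTwist x hφZ) (fun k => (fun z : Z => (z : M)) ⁻¹' N k)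
      ((fun z : Z' => (z : M')) ⁻¹' N') :=
  DecomposesTo.preimage ht (i' := Z'.subtype.toAddMonoidHom) Subtype.val_injective
    (subTwist_coe hφZ) (decomposesTo_range_subtype hZ) h h0

include ht hZ in
theorem decomposes_subTwist : Decomposes (subTwist x hφZ) :=
  Decomposes.of_injective ht (i := Z.subtype.toAddMonoidHom) (i' := Z'.subtype.toAddMonoidHom)
    Subtype.val_injective Subtype.val_injective
    (subTwist_coe hφZ) (decomposesTo_range_subtype hZ)

include ht hZ hW in
-- The decomposition first restricts to `Z` and then descends modulo `W`, because both submodules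
-- are described coordinatewise.
theorem SubQuot.decomposes : Decomposes (twist (SubQuot.map φ hφZ hφW).toAddMonoidHom x) := by
  refine (decomposes_subTwist ht hZ hφZ).of_surjective (mk_subTwist hφZ hφW)
    (Submodule.mkQ_surjective _) (Submodule.mkQ_surjective _) ?_
  have h := decomposesTo_preimage ht hZ hφZ hW (fun _ => zero_mem _)
  have h1 : {v : Z | (W.submoduleOf Z).mkQ.toAddMonoidHom v = 0} =
      (fun z : Z => (z : M)) ⁻¹' W := by
    ext v
    exact Submodule.Quotient.mk_eq_zero _
  have h2 : {v : Z' | (W'.submoduleOf Z').mkQ.toAddMonoidHom v = 0} =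
      (fun z : Z' => (z : M')) ⁻¹' W' := by
    ext v
    exact Submodule.Quotient.mk_eq_zero _
  rw [h1, h2]
  exact h

include ht hZ in
theorem SubQuot.decomposesTo_part {k₀ k₀' : Type} [CommRing k₀] [CommRing k₀'] [Algebra k₀ S]
    [Algebra k₀' S'] [Module k₀ M] [Module k₀' M'] [IsScalarTower k₀ S M] [IsScalarTower k₀' S' M']
    {N : κ → Submodule k₀ M} {N' : Submodule k₀' M'}
    (h : DecomposesTo (twist φ.toAddMonoidHom x) (fun k => (N k : Set M)) (N' : Set M')) :
    DecomposesTo (twist (SubQuot.map φ hφZ hφW).toAddMonoidHom x)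
      (fun k => (SubQuot.part k₀ Z W (N k) : Set (SubQuot Z W)))
      (SubQuot.part k₀' Z' W' N' : Set (SubQuot Z' W')) :=
  (decomposesTo_preimage ht hZ hφZ h fun _ => zero_mem _).image (mk_subTwist hφZ hφW)

section Differentials

variable {d : M →ₗ[S] M} {d' : M' →ₗ[S'] M'} (hd : ∀ m, φ (d m) = d' (φ m))

include hd

theorem map_mem_ker : ∀ z ∈ LinearMap.ker d, φ z ∈ LinearMap.ker d' := by
  intro z hz
  rw [LinearMap.mem_ker] at hz ⊢
  rw [← hd, hz, map_zero]

theorem map_mem_range : ∀ z ∈ LinearMap.range d, φ z ∈ LinearMap.range d' := by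
  rintro _ ⟨z, rfl⟩
  exact ⟨φ z, (hd z).symm⟩

theorem twist_comm (k : κ) (m : M) :
    d' (twist φ.toAddMonoidHom x k m) = twist φ.toAddMonoidHom x k (d m) := by
  change d' (x k • φ m) = x k • φ (d m)
  rw [map_smul, hd]

include ht

theorem decomposesTo_ker :
    DecomposesTo (twist φ.toAddMonoidHom x) (fun _ => (LinearMap.ker d : Set M))
      (LinearMap.ker d' : Set M') :=
  ht.ker ht (d := d.toAddMonoidHom) (d' := d'.toAddMonoidHom) (twist_comm hd)

theorem decomposesTo_range :
    DecomposesTo (twist φ.toAddMonoidHom x) (fun _ => (LinearMap.range d : Set M))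
      (LinearMap.range d' : Set M') :=
  ht.range (d := d.toAddMonoidHom) (d' := d'.toAddMonoidHom) (twist_comm hd)

end Differentials

/-- The map on homology induced by a semilinear chain map. -/
def Homology.map (φ : M →ₛₗ[σ] M') {d : M →ₗ[S] M} {d' : M' →ₗ[S'] M'}
    (hd : ∀ m, φ (d m) = d' (φ m)) : Homology d →ₛₗ[σ] Homology d' :=
  SubQuot.map φ (map_mem_ker hd) (map_mem_range hd)

include ht in
theorem Homology.decomposes {d : M →ₗ[S] M} {d' : M' →ₗ[S'] M'} (hd : ∀ m, φ (d m) = d' (φ m)) :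
    Decomposes (twist (Homology.map φ hd).toAddMonoidHom x) :=
  SubQuot.decomposes ht (decomposesTo_ker ht hd) (decomposesTo_range ht hd) _ _

include ht in
theorem Homology.decomposesTo_part {d : M →ₗ[S] M} {d' : M' →ₗ[S'] M'}
    (hd : ∀ m, φ (d m) = d' (φ m)) {k₀ k₀' : Type} [CommRing k₀] [CommRing k₀'] [Algebra k₀ S]
    [Algebra k₀' S'] [Module k₀ M] [Module k₀' M'] [IsScalarTower k₀ S M] [IsScalarTower k₀' S' M']
    {N : κ → Submodule k₀ M} {N' : Submodule k₀' M'}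
    (h : DecomposesTo (twist φ.toAddMonoidHom x) (fun k => (N k : Set M)) (N' : Set M')) :
    DecomposesTo (twist (Homology.map φ hd).toAddMonoidHom x)
      (fun k => (SubQuot.part k₀ (LinearMap.ker d) (LinearMap.range d) (N k) : Set (Homology d)))
      (SubQuot.part k₀' (LinearMap.ker d') (LinearMap.range d') N' : Set (Homology d')) :=
  SubQuot.decomposesTo_part ht (decomposesTo_ker ht hd) _ _ h

end SubQuotients

/-! ### Free extensions and the cube -/

section Cubes

variable {κ S S' : Type} [CommRing S] [CommRing S'] {n : ℕ}

/-- The map between cubes induced by a ring homomorphism. -/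
def cubeMap (σ : S →+* S') (n : ℕ) : Cube S n →ₛₗ[σ] Cube S' n where
  toFun f s := σ (f s)
  map_add' f g := by
    funext s
    simp
  map_smul' r f := by
    funext s
    simp

theorem map_coefH (σ : S →+* S') (pos : Bool) (a b : S) (top : Bool) :
    σ (coefH pos a b top) = coefH pos (σ a) (σ b) top := by
  cases pos <;> cases top <;> simp [coefH]

theorem map_coefV (σ : S →+* S') (pos : Bool) (b : S) (right : Bool) :
    σ (coefV pos b right) = coefV pos (σ b) right := by
  cases pos <;> cases right <;> simp [coefV]

theorem map_signH (σ : S →+* S') (h : Fin n → Bool) (c : Fin n) :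
    σ (signH h c) = signH h c := by
  simp only [signH, map_prod]
  refine Finset.prod_congr rfl fun c' _ => ?_
  split_ifs <;> simp

theorem map_signV (σ : S →+* S') (pos v : Fin n → Bool) (c : Fin n) :
    σ (signV pos v c) = signV pos v c := by
  simp only [signV, map_prod]
  refine Finset.prod_congr rfl fun c' _ => ?_
  split_ifs <;> simp

variable (σ : S →+* S') (pos : Fin n → Bool) {a b : Fin n → S} {a' b' : Fin n → S'}
  (ha : ∀ t, a' t = σ (a t)) (hb : ∀ t, b' t = σ (b t))

include ha hb in
theorem cubeMap_dPlus (f : Cube S n) :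
    cubeMap σ n (dPlus pos a b f) = dPlus pos a' b' (cubeMap σ n f) := by
  funext s
  change σ (∑ c : Fin n, _) = ∑ c : Fin n, _
  rw [map_sum]
  refine Finset.sum_congr rfl fun c _ => ?_
  split_ifs
  · rw [map_mul, map_mul, map_signH, map_coefH, ha, hb]
    rfl
  · exact map_zero σ

include hb in
theorem cubeMap_dV (f : Cube S n) :
    cubeMap σ n (dV pos b f) = dV pos b' (cubeMap σ n f) := by
  funext s
  change σ (∑ c : Fin n, _) = ∑ c : Fin n, _
  rw [map_sum]
  refine Finset.sum_congr rfl fun c _ => ?_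
  split_ifs
  · rw [map_mul, map_mul, map_signV, map_coefV, hb]
    rfl
  · exact map_zero σ

/-- The map on the horizontal homology of the cubes. -/
def horizontalMap : Homology (dPlus pos a b) →ₛₗ[σ] Homology (dPlus pos a' b') :=
  Homology.map (cubeMap σ n) (cubeMap_dPlus σ pos ha hb)

theorem horizontalMap_dVInd (z : Homology (dPlus pos a b)) :
    horizontalMap σ pos ha hb (dVInd pos a b z) =
      dVInd pos a' b' (horizontalMap σ pos ha hb z) := by
  obtain ⟨z, rfl⟩ := Submodule.Quotient.mk_surjective _ z
  change Submodule.Quotient.mk _ = Submodule.Quotient.mk _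
  congr 1
  exact Subtype.ext (cubeMap_dV σ pos hb z.1)

/-- The map on the iterated homology of the cubes. -/
def cubeHomologyMap : CubeHomology pos a b →ₛₗ[σ] CubeHomology pos a' b' :=
  Homology.map (horizontalMap σ pos ha hb) (horizontalMap_dVInd σ pos ha hb)

end Cubes

/-! ### The cube and its iterated homology under a free extension of rings. -/

section CubeExtension

variable {κ S S' : Type} [CommRing S] [CommRing S'] [Algebra ℚ S] [Algebra ℚ S']
  {𝒮 : ℤ → Submodule ℚ S} {𝒮' : ℤ → Submodule ℚ S'} {j : S →ₐ[ℚ] S'} {x : κ → S'}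
  {wt : κ → ℤ} (h : FreeExtension 𝒮 𝒮' j x wt) {n : ℕ} (pos : Fin n → Bool)
  {a b : Fin n → S} {a' b' : Fin n → S'}
  (ha : ∀ t, a' t = j.toRingHom (a t)) (hb : ∀ t, b' t = j.toRingHom (b t))

include h

theorem cube_decomposes : Decomposes (twist (cubeMap j.toRingHom n).toAddMonoidHom x) :=
  h.dec.pi (Corner n)

theorem cubeBideg_decomposesTo (J K : ℤ) :
    DecomposesTo (twist (cubeMap j.toRingHom n).toAddMonoidHom x)
      (fun _ => (cubeBideg (S := S) pos J K : Set (Cube S n)))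
      (cubeBideg (S := S') pos J K : Set (Cube S' n)) := by
  classical
  -- Membership is a condition at each corner separately: no condition at corners of bidegree `(J,
  -- K)`, vanishing at all others. This lets `DecomposesTo.pi` apply.
  have h1 : ∀ (R : Type) [CommRing R], (cubeBideg (S := R) pos J K : Set (Cube R n)) =
      {f | ∀ s, f s ∈ if (∑ c, gradH (s.1 c) = J ∧ ∑ c, gradV (pos c) (s.2 c) = K)
        then (Set.univ : Set R) else {0}} := by
    intro R _
    ext f
    refine forall_congr' fun s => ?_
    split_ifs with hs <;> simp [hs]
  rw [h1, h1]
  refine DecomposesTo.pi (t := twist j.toRingHom.toAddMonoidHom x) (fun s => ?_) fun s _ => ?_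
  · split_ifs
    exacts [h.dec.univ, decomposesTo_zero _]
  · split_ifs <;> simp

theorem cubeDeg_decomposesTo (i J K : ℤ) :
    DecomposesTo (twist (cubeMap j.toRingHom n).toAddMonoidHom x)
      (fun k => (cubeDeg 𝒮 pos (i - wt k) J K : Set (Cube S n)))
      (cubeDeg 𝒮' pos i J K : Set (Cube S' n)) := by
  classical
  have h1 : ∀ (R : Type) [CommRing R] [Algebra ℚ R] (𝓡 : ℤ → Submodule ℚ R) (i : ℤ),
      (cubeDeg 𝓡 pos i J K : Set (Cube R n)) =
      {f | ∀ s, f s ∈ if (∑ c, gradH (s.1 c) = J ∧ ∑ c, gradV (pos c) (s.2 c) = K)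
        then (𝓡 (i - ∑ c, shiftQ (pos c) (s.1 c) (s.2 c)) : Set R) else {0}} := by
    intro R _ _ 𝓡 i
    ext f
    change (∀ s, _) ∧ (∀ s, _) ↔ _
    rw [← forall_and]
    refine forall_congr' fun s => ?_
    split_ifs with hs
    · simp [hs]
    · simp only [hs, not_false_eq_true, forall_const, Set.mem_singleton_iff, and_iff_left_iff_imp]
      intro h0
      rw [h0]
      exact zero_mem _
  simp only [h1]
  refine DecomposesTo.pi (t := twist j.toRingHom.toAddMonoidHom x) (fun s => ?_) fun s _ => ?_
  · split_ifs
    · have := h.decDeg (i - ∑ c, shiftQ (pos c) (s.1 c) (s.2 c))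
      simp only [sub_right_comm i _ (wt _)] at this
      exact this
    · exact decomposesTo_zero _
  · split_ifs <;> simp

theorem horizontal_decomposes :
    Decomposes (twist (horizontalMap j.toRingHom pos ha hb).toAddMonoidHom x) :=
  Homology.decomposes (cube_decomposes h) _

theorem cubeHomology_decomposes :
    Decomposes (twist (cubeHomologyMap j.toRingHom pos ha hb).toAddMonoidHom x) :=
  Homology.decomposes (horizontal_decomposes h pos ha hb) _

theorem homologyBideg_decomposesTo (J K : ℤ) :
    DecomposesTo (twist (cubeHomologyMap j.toRingHom pos ha hb).toAddMonoidHom x)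
      (fun _ => (homologyBideg pos a b J K : Set (CubeHomology pos a b)))
      (homologyBideg pos a' b' J K : Set (CubeHomology pos a' b')) :=
  Homology.decomposesTo_part (horizontal_decomposes h pos ha hb) _
    (Homology.decomposesTo_part (cube_decomposes h) _ (cubeBideg_decomposesTo h pos J K))

theorem homologyDeg_decomposesTo (i J K : ℤ) :
    DecomposesTo (twist (cubeHomologyMap j.toRingHom pos ha hb).toAddMonoidHom x)
      (fun k => (homologyDeg 𝒮 pos a b (i - wt k) J K : Set (CubeHomology pos a b)))
      (homologyDeg 𝒮' pos a' b' i J K : Set (CubeHomology pos a' b')) :=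
  Homology.decomposesTo_part (horizontal_decomposes h pos ha hb) _
    (Homology.decomposesTo_part (cube_decomposes h) _ (cubeDeg_decomposesTo h pos i J K))

end CubeExtension

theorem rank_eq_of_decomposesTo {V W : Type} [AddCommGroup V] [AddCommGroup W] [Module ℚ V]
    [Module ℚ W] {t : Unit → V →+ W} (ht : Decomposes t) {N : Submodule ℚ V} {N' : Submodule ℚ W}
    (h : DecomposesTo t (fun _ => (N : Set V)) (N' : Set W)) :
    Module.rank ℚ N' = Module.rank ℚ N := by
  have h1 : ∀ v : Unit →₀ V, assemble t v = t () (v ()) := by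
    intro v
    obtain ⟨r, rfl⟩ : ∃ r, v = Finsupp.single () r := ⟨v (), by ext; simp⟩
    rw [assemble_single, Finsupp.single_eq_same]
  have hi : Function.Injective (t ()) := by
    intro v w hvw
    have := ht.1 (a₁ := Finsupp.single () v) (a₂ := Finsupp.single () w) (by
      rw [assemble_single, assemble_single, hvw])
    exact Finsupp.single_injective _ this
  -- An additive map between rational vector spaces is automatically linear.
  have hN : N.map (t ()).toRatLinearMap = N' := by
    ext w
    constructor
    · rintro ⟨v, hv, rfl⟩
      exact h.mem () v hv
    · intro hw
      obtain ⟨v, hv, rfl⟩ := h.exists_eq w hw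
      exact ⟨v (), hv (), (h1 v).symm⟩
  rw [← hN]
  exact (Submodule.equivMapOfInjective _ hi N).rank_eq.symm

/-! ### Betti numbers and restriction of scalars -/

section RestrictScalars

variable {κ A A' S S' M M' : Type} [CommRing A] [CommRing A'] [CommRing S] [CommRing S']
  [Algebra ℚ A] [Algebra ℚ A'] [Algebra ℚ S] [Algebra ℚ S']
  {𝒜 : ℤ → Submodule ℚ A} {𝒜' : ℤ → Submodule ℚ A'}
  [SetLike.GradedMonoid 𝒜] [SetLike.GradedMonoid 𝒜']
  [AddCommGroup M] [Module S M] [Module ℚ M] {ℳ : ℤ → Submodule ℚ M}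
  [AddCommGroup M'] [Module S' M'] [Module ℚ M'] {ℳ' : ℤ → Submodule ℚ M'}

/-- The module structures here are pulled back along `f` and `f'`. As these are compatible with `i`
and `j`, semilinearity over `j` becomes semilinearity over `i`, and the basis element `x k` acts as
`f' (x k)`. -/
theorem bettiNumber_compHom_eq_of_freeExtension (f : A →ₐ[ℚ] S) (f' : A' →ₐ[ℚ] S')
    {i : A →ₐ[ℚ] A'} {j : S →ₐ[ℚ] S'} (hf : ∀ r, f' (i r) = j (f r)) {x : κ → A'} {wt : κ → ℤ}
    (h : FreeExtension 𝒜 𝒜' i x wt) {φ : M →ₛₗ[j.toRingHom] M'} {s : ℤ}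
    (hφ : Decomposes (twist φ.toAddMonoidHom fun k => f' (x k)))
    (hφd : ∀ q, DecomposesTo (twist φ.toAddMonoidHom fun k => f' (x k))
      (fun k => (ℳ (q - s - wt k) : Set M)) (ℳ' q : Set M'))
    (c : A →ₐ[ℚ] ℚ) (c' : A' →ₐ[ℚ] ℚ) (hc : ∀ r, c' (i r) = c r)
    (hc' : ∀ n, n ≠ 0 → ∀ r ∈ 𝒜' n, c' r = 0) (I : Ideal A) (hI : ∀ r, r ∈ I ↔ c r = 0)
    (I' : Ideal A') (hI' : ∀ r, r ∈ I' ↔ c' r = 0) (p : ℕ) (q : ℤ) :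
    letI : Module A M := Module.compHom M f.toRingHom
    letI : Module A' M' := Module.compHom M' f'.toRingHom
    bettiNumber 𝒜' I' ℳ' p q = bettiNumber 𝒜 I ℳ p (q - s) := by
  let : Module A M := Module.compHom M f.toRingHom
  let : Module A' M' := Module.compHom M' f'.toRingHom
  refine bettiNumber_eq_of_freeExtension h (φ := φ.toAddMonoidHom) hφ (fun r m => ?_) hφd c c' hc
    hc' I hI I' hI' p q
  have h1 : φ (f r • m) = j (f r) • φ m := map_smulₛₗ φ (f r) m
  rw [← hf] at h1
  exact h1

variable [IsScalarTower ℚ S M] (ℳ) (f : A →ₐ[ℚ] S) {c : A →ₐ[ℚ] ℚ}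
  (hA : ∀ r, algebraMap ℚ A (c r) = r) (hc : ∀ n, n ≠ 0 → ∀ r ∈ 𝒜 n, c r = 0)
  (I : Ideal A) (hI : ∀ r, r ∈ I ↔ c r = 0)

omit [SetLike.GradedMonoid 𝒜] in
theorem isScalarTower_compHom :
    letI : Module A M := Module.compHom M f.toRingHom
    IsScalarTower ℚ A M := by
  let : Module A M := Module.compHom M f.toRingHom
  refine ⟨fun r a m => ?_⟩
  change f (r • a) • m = r • (f a • m)
  rw [map_smul, smul_assoc]

include hA hc hI

theorem bettiNumber_compHom_succ_eq_zero (p : ℕ) (q : ℤ) :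
    letI : Module A M := Module.compHom M f.toRingHom
    bettiNumber 𝒜 I ℳ (p + 1) q = 0 := by
  let : Module A M := Module.compHom M f.toRingHom
  have := isScalarTower_compHom (M := M) f
  exact bettiNumber_succ_eq_zero ℳ hA hc I hI p q

theorem bettiNumber_compHom_zero_eq_rank (q : ℤ) :
    letI : Module A M := Module.compHom M f.toRingHom
    bettiNumber 𝒜 I ℳ 0 q = Module.rank ℚ (ℳ q) := by
  let : Module A M := Module.compHom M f.toRingHom
  have := isScalarTower_compHom (M := M) f
  exact bettiNumber_zero_eq_rank ℳ hA hc I hI q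

end RestrictScalars

theorem homologyDeg_le_homologyBideg {S : Type} [CommRing S] [Algebra ℚ S]
    (𝒮 : ℤ → Submodule ℚ S) {n : ℕ} (pos : Fin n → Bool) (a b : Fin n → S) (i J K : ℤ) :
    homologyDeg 𝒮 pos a b i J K ≤ (homologyBideg pos a b J K).restrictScalars ℚ := by
  rintro _ ⟨y, hy, rfl⟩
  refine ⟨y, ?_, rfl⟩
  obtain ⟨z, hz, hzy⟩ := hy
  exact ⟨z, hz.1, hzy⟩

/-! ### The homology of a closed braid over its reduction, and the Betti numbers. -/

namespace ClosedBraid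

variable (B : ClosedBraid)

theorem edgeA_eq (t : Fin B.len) : B.edgeA t = B.redToEdge.toRingHom (B.redA t) := rfl

theorem edgeB_eq (t : Fin B.len) : B.edgeB t = B.redToEdge.toRingHom (B.redB t) := rfl

/-- The map from the homology over the reduced edge ring to that over the edge ring. -/
def homologyMap : B.ReductionHomology →ₛₗ[B.redToEdge.toRingHom] B.MiddleHomology :=
  cubeHomologyMap B.redToEdge.toRingHom B.pos B.edgeA_eq B.edgeB_eq

theorem homologyMap_mem {j k : ℤ} : ∀ z ∈ B.Hr j k, B.homologyMap z ∈ B.H j k := by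
  intro z hz
  -- There is at least one strand, hence an edge. The map itself is the summand of the decomposition
  -- belonging to `X_{v₀}^0 = 1`.
  obtain ⟨v₀⟩ : Nonempty B.Edge := ⟨Quot.mk _ (0, 0)⟩
  have := (homologyBideg_decomposesTo (B.freeExtension_edgeRing v₀) B.pos B.edgeA_eq B.edgeB_eq
    (j - (B.writhe + B.strands - 1)) (k - (B.writhe - B.strands + 1))).mem 0 z hz
  rw [twist_apply, pow_zero, one_smul] at this
  exact this

/-- The map `H_r^{⋆,j,k} → H^{⋆,j,k}`. -/
def bidegMap (j k : ℤ) : B.Hr j k →ₛₗ[B.redToEdge.toRingHom] B.H j k :=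
  (B.homologyMap.domRestrict (B.Hr j k)).codRestrict (B.H j k)
    fun z => B.homologyMap_mem z.1 z.2

theorem bidegMap_decomposes (v₀ : B.Edge) (j k : ℤ) :
    Decomposes (twist (B.bidegMap j k).toAddMonoidHom
      (fun n : ℕ => B.toEdgeRing (MvPolynomial.X v₀) ^ n)) :=
  decomposes_subTwist (cubeHomology_decomposes (B.freeExtension_edgeRing v₀) B.pos B.edgeA_eq
    B.edgeB_eq) (homologyBideg_decomposesTo (B.freeExtension_edgeRing v₀) B.pos B.edgeA_eq
    B.edgeB_eq _ _) B.homologyMap_mem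

/-- The power `X_{v₀}^n` contributes `2 * n` to the first degree; the remaining `1` is the
difference between the normalizations of `H` and `H_r`. -/
theorem bidegMap_decomposesTo (v₀ : B.Edge) (j k q : ℤ) :
    DecomposesTo (twist (B.bidegMap j k).toAddMonoidHom
      (fun n : ℕ => B.toEdgeRing (MvPolynomial.X v₀) ^ n))
      (fun n => (B.HrDeg j k (q - 1 - 2 * n) : Set (B.Hr j k))) (B.HDeg j k q : Set (B.H j k)) := by
  have h := homologyDeg_decomposesTo (B.freeExtension_edgeRing v₀) B.pos B.edgeA_eq B.edgeB_eq
    (q - (-B.writhe + B.strands)) (j - (B.writhe + B.strands - 1))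
    (k - (B.writhe - B.strands + 1))
  have h2 := decomposesTo_preimage (cubeHomology_decomposes (B.freeExtension_edgeRing v₀) B.pos
    B.edgeA_eq B.edgeB_eq) (homologyBideg_decomposesTo (B.freeExtension_edgeRing v₀) B.pos
    B.edgeA_eq B.edgeB_eq _ _) (B.homologyMap_mem (j := j) (k := k)) h (fun _ => zero_mem _)
  have h3 : ∀ n : ℕ, q - (-B.writhe + B.strands) - 2 * n =
      q - 1 - 2 * n - (-B.writhe + B.strands - 1) := fun n => by ring
  simp only [h3] at h2
  exact h2

theorem betti_eq_bettiReduced (e : B.Component → B.Edge) (p : ℕ) (q j k : ℤ) :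
    B.betti e p q j k = B.bettiReduced e p (q - 1) j k := by
  -- Any component would do. Taking `v₀ = e K₀` makes the powers of `X_{v₀}` the action of the basis
  -- `X_{K₀}^n` of `R_B` over `R_{B,r}`.
  let K₀ : B.Component := Quot.mk _ (Quot.mk _ (0, 0))
  have hx : (fun n : ℕ => B.actionMap e (MvPolynomial.X K₀ ^ n)) =
      fun n : ℕ => B.toEdgeRing (MvPolynomial.X (e K₀)) ^ n := by
    funext n
    rw [map_pow, actionMap, AlgHom.comp_apply, MvPolynomial.rename_X]
  have h1 : Decomposes (twist (B.bidegMap j k).toAddMonoidHom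
      fun n : ℕ => B.actionMap e (MvPolynomial.X K₀ ^ n)) := by
    rw [hx]
    exact B.bidegMap_decomposes (e K₀) j k
  have h2 : ∀ q, DecomposesTo (twist (B.bidegMap j k).toAddMonoidHom
      fun n : ℕ => B.actionMap e (MvPolynomial.X K₀ ^ n))
      (fun n => (B.HrDeg j k (q - 1 - 2 * n) : Set (B.Hr j k))) (B.HDeg j k q : Set (B.H j k)) := by
    rw [hx]
    exact B.bidegMap_decomposesTo (e K₀) j k
  exact bettiNumber_compHom_eq_of_freeExtension (ℳ := B.HrDeg j k) (ℳ' := B.HDeg j k)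
    (B.reducedActionMap e) (B.actionMap e) (fun _ => rfl) (freeExtension_diffRing K₀) h1 h2
    (diffAug B.Component) (polyAug B.Component) (fun _ => rfl) (fun n hn r => polyAug_eq_zero hn)
    _ mem_span_diffX_iff _ mem_span_X_iff p q

theorem IsKnot.subsingleton {B : ClosedBraid} (hB : B.IsKnot) : Subsingleton B.Component :=
  (Nat.card_eq_one_iff_unique.1 hB).1

theorem bettiReduced_zero (hB : B.IsKnot) (e : B.Component → B.Edge) (q j k : ℤ) :
    B.bettiReduced e 0 q j k = Module.rank ℚ (B.HrDeg j k q) :=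
  have := hB.subsingleton
  bettiNumber_compHom_zero_eq_rank (B.HrDeg j k) (B.reducedActionMap e) algebraMap_diffAug
    (fun _ hn _ => diffAug_eq_zero hn) _ mem_span_diffX_iff q

theorem bettiReduced_succ (hB : B.IsKnot) (e : B.Component → B.Edge) (p : ℕ) (q j k : ℤ) :
    B.bettiReduced e (p + 1) q j k = 0 :=
  have := hB.subsingleton
  bettiNumber_compHom_succ_eq_zero (B.HrDeg j k) (B.reducedActionMap e) algebraMap_diffAug
    (fun _ hn _ => diffAug_eq_zero hn) _ mem_span_diffX_iff p q

/-- The composite `R_r(B) → R(B) → R(B) / (X_x)` is a graded isomorphism, so the two cubes have the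
same homology. -/
theorem rank_HbarDeg (x : B.Edge) (i j k : ℤ) :
    Module.rank ℚ (B.HbarDeg x i j k) = Module.rank ℚ (B.HrDeg j k i) := by
  have h := B.freeExtension_markedEdgeRing x
  have ha : ∀ t, B.markedA x t =
    ((B.toMarkedEdgeRing x).comp B.redToEdge).toRingHom (B.redA t) := fun _ => rfl
  have hb : ∀ t, B.markedB x t =
    ((B.toMarkedEdgeRing x).comp B.redToEdge).toRingHom (B.redB t) := fun _ => rfl
  have h1 := homologyDeg_decomposesTo h B.pos ha hb (i - (-B.writhe + B.strands - 1))
    (j - (B.writhe + B.strands - 1)) (k - (B.writhe - B.strands + 1))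
  simp only [sub_zero] at h1
  refine (rank_eq_of_decomposesTo (cubeHomology_decomposes h B.pos ha hb) h1).trans ?_
  have hi : Function.Injective ((B.Hr j k).subtype.restrictScalars ℚ) := Subtype.val_injective
  refine Eq.trans ?_ (Submodule.equivMapOfInjective _ hi (B.HrDeg j k i)).rank_eq.symm
  -- `HrDeg` is the homogeneous part pulled back to the submodule `Hr`; nothing is lost, since that
  -- part is contained in the submodule.
  rw [HrDeg, Submodule.map_comap_eq_of_le]
  intro z hz
  exact ⟨⟨z, homologyDeg_le_homologyBideg _ _ _ _ _ _ _ hz⟩, rfl⟩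

end ClosedBraid

end

end HOMFLYPT

theorem theorem1p5 (B : HOMFLYPT.ClosedBraid) (e : B.Component → B.Edge)
    (he : ∀ K : B.Component, B.component (e K) = K) :
    (∀ (p : ℕ) (q j k : ℤ), B.betti e p q j k = B.bettiReduced e p (q - 1) j k) ∧
    (B.IsKnot →
      (∀ q j k : ℤ, B.betti e 0 q j k = Module.rank ℚ (B.HrDeg j k (q - 1))) ∧
      (∀ (x : B.Edge) (q j k : ℤ),
        B.betti e 0 q j k = Module.rank ℚ (B.HbarDeg x (q - 1) j k)) ∧
      (∀ (p : ℕ) (q j k : ℤ), 0 < p → B.betti e p q j k = 0)) := by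
  refine ⟨B.betti_eq_bettiReduced e, fun hB => ⟨fun q j k => ?_, fun x q j k => ?_,
    fun p q j k hp => ?_⟩⟩
  · rw [B.betti_eq_bettiReduced, B.bettiReduced_zero hB]
  · rw [B.betti_eq_bettiReduced, B.bettiReduced_zero hB, B.rank_HbarDeg]
  · obtain ⟨p, rfl⟩ := Nat.exists_eq_succ_of_ne_zero hp.ne'
    rw [B.betti_eq_bettiReduced, B.bettiReduced_succ hB]
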